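/- **Conventions.** $\mathbb T$ is $[0,\infty)$ or $\mathbb N_0$ (more generally, any linearly ordered, cancellative commutative additive monoid in which $s\le t$ holds exactly when $t=s+r$ for some $r$). $\mathcal B$ is a unital $C^*$-algebra. Hilbert $\mathcal B$-modules are right modules with inner product $\mathcal B$-linear in the second argument. $\mathcal B^a(E)$ is the $C^*$-algebra of adjointable operators on a Hilbert module $E$; $xy^*\in\mathcal B^a(E)$ is the rank-one operator $z\mapsto x\langle y,z\rangle$, and $\mathcal K(E)=\overline{\operatorname{span}}\{xy^*:x,y\in E\}$. A *unit vector* is a vector $\xi$ with $\langle\xi,\xi\rangle=\mathbf 1$. A *correspondence over* $\mathcal B$ is a Hilbert $\mathcal B$-module $F$ with a unital $*$-homomorphism $\mathcal B\to\mathcal B^a(F)$ as left action; a vector $\omega\in F$ is *central* if $b\omega=\omega b$ for all $b\in\mathcal B$. $\odot$ is the internal tensor product, with $\langle x\odot y,x'\odot y'\rangle=\langle y,\langle x,x'\rangle y'\rangle$. Let $E_+$ be a Hilbert $\mathcal B$-module and let $\vartheta=(\vartheta_t)_{t\in\mathbb T}$ be an $E_0$-semigroup on $\mathcal B^a(E_+)$,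 that is, a family of unital $*$-endomorphisms with $\vartheta_0=\mathrm{id}$ and $\vartheta_{s+t}=\vartheta_s\circ\vartheta_t$. It is *strict* if $\overline{\operatorname{span}}\,\vartheta_t(\mathcal K(E_+))E_+=E_+$ for all $t$. Its product system consists of $E_0=\mathcal B$ and, for $t\neq0$, the correspondences $E_t=E_+^*\odot_{\vartheta_t}E_+$ over $\mathcal B$. Here $E_+^*=\{x^*:x\in E_+\}$ is the dual correspondence from $\mathcal B$ to $\mathcal B^a(E_+)$, with inner product $\langle x^*,y^*\rangle=xy^*$ and operations $bx^*a=(a^*xb^*)^*$, and $\mathcal B^a(E_+)$ acts on the right factor $E_+$ via $\vartheta_t$. The products $u_{st}:E_s\odot E_t\to E_{s+t}$ are determined by $$u_{st}\big((x^*\odot x')\odot(y^*\odot y')\big)=x^*\odot\vartheta_t(x'y^*)y'\qquad(s,t\ne0),$$ and are the canonical ones if $s=0$ or $t=0$. $\vartheta$ is *spatial* if there is a central unital unit, that is, a family of central unit vectors $\omega_t\in E_t$ with $\omega_0=\mathbf 1$ and $u_{st}(\omega_s\odot\omega_t)=\omega_{s+t}$ for all $s,t\in\mathbb T$. A *unital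 CP-semigroup* on $\mathcal B$ is a family $T=(T_t)_{t\in\mathbb T}$ of unital completely positive maps on $\mathcal B$ with $T_0=\mathrm{id}$ and $T_{s+t}=T_s\circ T_t$. For $\xi_+\in E_+$, the triple $(E_+,\vartheta,\xi_+)$ is a *weak dilation* of $T$ if $\xi_+$ is a unit vector, $\vartheta_t(\xi_+\xi_+^*)\ge\xi_+\xi_+^*$ for all $t$, and $T_t(b)=\langle\xi_+,\vartheta_t(\xi_+b\xi_+^*)\xi_+\rangle$ for all $t\in\mathbb T$ and $b\in\mathcal B$. **Theorem.** Let $\vartheta$ be a spatial strict $E_0$-semigroup on $\mathcal B^a(E_+)$, and let $(E_+,\vartheta,\xi_+)$ be a weak dilation of the unital CP-semigroup $T$ on $\mathcal B$. Then there exist a correspondence $E_-$ over $\mathcal B$, a semigroup $w=(w_t)_{t\in\mathbb T}$ of unitaries in $\mathcal B^a(E_+\odot E_-)$ (with $w_0=\mathrm{id}$ and $w_{s+t}=w_sw_t$), and a vector $\omega_-\in E_-$ such that, with $\alpha_t:=w_t\bullet w_t^*$: 1. the canonical homomorphism $a\mapsto a\odot\mathrm{id}_{E_-}$ from $\mathcal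 B^a(E_+)$ onto $\mathcal B^a(E_+)\odot\mathrm{id}_{E_-}$ is an isomorphism; 2. $\alpha_t(a\odot\mathrm{id}_{E_-})=\vartheta_t(a)\odot\mathrm{id}_{E_-}$ for all $t\in\mathbb T$ and $a\in\mathcal B^a(E_+)$; 3. $\omega_-$ is a central unit vector; 4. $\alpha$ is a dilation of $T$ with respect to the embedding $b\mapsto\xi_+b\xi_+^*\odot\mathrm{id}_{E_-}$ in the vector expectation $\langle\xi_+\odot\omega_-,\bullet\,\xi_+\odot\omega_-\rangle$: this embedding is an injective $*$-homomorphism $\mathcal B\to\mathcal B^a(E_+\odot E_-)$, $\xi_+\odot\omega_-$ is a unit vector, and $$\big\langle\xi_+\odot\omega_-,\ \alpha_t(\xi_+b\xi_+^*\odot\mathrm{id}_{E_-})\,(\xi_+\odot\omega_-)\big\rangle=T_t(b)\qquad(t\in\mathbb T,\ b\in\mathcal B).$$ -/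

import Mathlib

open scoped InnerProductSpace NNReal TensorProduct CStarAlgebra
open MulOpposite UniformSpace

universe u v w

set_option linter.unusedSectionVars false

noncomputable section

namespace HilbMod

/-! ### Hilbert modules -/

/-- A right module `V` over a unital `C⋆`-algebra `B` with a `B`-valued semi-inner product,
`B`-linear in the second argument. The right action `x b` is written `op b • x`. (Mathlib's
`CStarModule` has the `B`-linearity on the left, so it is not the notion wanted here.) -/
class SemiHilbert (B : Type u) (V : Type v) [CStarAlgebra B] [PartialOrder B]
    [AddCommGroup V] [Module ℂ V] [Module Bᵐᵒᵖ V] extends Inner B V where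
  ip_add_right : ∀ x y z : V, inner x (y + z) = inner x y + inner x z
  ip_smul_right : ∀ (c : ℂ) (x y : V), inner x (c • y) = c • inner x y
  ip_op_smul_right : ∀ (b : B) (x y : V), inner x (op b • y) = inner x y * b
  star_ip : ∀ x y : V, star (inner x y) = inner y x
  ip_self_nonneg : ∀ x : V, 0 ≤ inner x x

/-- A (right) Hilbert `B`-module: a `B`-valued inner product, complete in the norm
`‖x‖ = ‖⟪x, x⟫‖ ^ (1/2)`; definiteness holds because `‖·‖` is a norm. -/
class HilbertModule (B : Type u) (E : Type v) [CStarAlgebra B] [PartialOrder B]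
    [NormedAddCommGroup E] [NormedSpace ℂ E] [CompleteSpace E] [Module Bᵐᵒᵖ E]
    extends SemiHilbert B E where
  norm_eq : ∀ x : E, ‖x‖ = √‖inner x x‖

section Semi

variable {B : Type u} {V : Type v} [CStarAlgebra B] [PartialOrder B]
  [AddCommGroup V] [Module ℂ V] [Module Bᵐᵒᵖ V] [SemiHilbert B V]

namespace SemiHilbert

lemma ip_add_left (x y z : V) : ⟪x + y, z⟫_B = ⟪x, z⟫_B + ⟪y, z⟫_B := by
  rw [← star_ip, ip_add_right, star_add, star_ip, star_ip]

lemma ip_smul_left (c : ℂ) (x y : V) : ⟪c • x, y⟫_B = star c • ⟪x, y⟫_B := by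
  rw [← star_ip, ip_smul_right, star_smul, star_ip]

lemma ip_op_smul_left (b : B) (x y : V) : ⟪op b • x, y⟫_B = star b * ⟪x, y⟫_B := by
  rw [← star_ip, ip_op_smul_right, star_mul, star_ip]

/-- The semi-inner product, additive in both arguments. -/
def ipHom (B : Type u) {V : Type v} [CStarAlgebra B] [PartialOrder B]
    [AddCommGroup V] [Module ℂ V] [Module Bᵐᵒᵖ V] [SemiHilbert B V] : V →+ V →+ B :=
  AddMonoidHom.mk' (fun x => AddMonoidHom.mk' (fun y => ⟪x, y⟫_B) (ip_add_right x))
    (fun x y => by ext z; exact ip_add_left x y z)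

lemma ipHom_apply (x y : V) : ipHom B x y = ⟪x, y⟫_B := rfl

lemma ip_zero_right (x : V) : ⟪x, (0 : V)⟫_B = 0 := map_zero (ipHom B x)

lemma ip_zero_left (x : V) : ⟪(0 : V), x⟫_B = 0 := by
  rw [← ipHom_apply, map_zero, AddMonoidHom.zero_apply]

lemma ip_neg_right (x y : V) : ⟪x, -y⟫_B = -⟪x, y⟫_B := map_neg (ipHom B x) y

lemma ip_neg_left (x y : V) : ⟪-x, y⟫_B = -⟪x, y⟫_B := by
  rw [← ipHom_apply, map_neg, AddMonoidHom.neg_apply, ipHom_apply]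

lemma ip_sub_right (x y z : V) : ⟪x, y - z⟫_B = ⟪x, y⟫_B - ⟪x, z⟫_B :=
  map_sub (ipHom B x) y z

lemma ip_sub_left (x y z : V) : ⟪x - y, z⟫_B = ⟪x, z⟫_B - ⟪y, z⟫_B := by
  simp only [← ipHom_apply, map_sub, AddMonoidHom.sub_apply]

lemma ip_sum_left {ι : Type*} (s : Finset ι) (f : ι → V) (y : V) :
    ⟪∑ i ∈ s, f i, y⟫_B = ∑ i ∈ s, ⟪f i, y⟫_B := by
  simp only [← ipHom_apply, map_sum, AddMonoidHom.finsetSum_apply]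

lemma ip_sum_right {ι : Type*} (s : Finset ι) (f : ι → V) (y : V) :
    ⟪y, ∑ i ∈ s, f i⟫_B = ∑ i ∈ s, ⟪y, f i⟫_B := by
  simp only [← ipHom_apply, map_sum]

variable [StarOrderedRing B]

lemma ip_mul_ip_le (x y : V) {c : ℝ} (hc : 0 < c) (h : ‖⟪x, x⟫_B‖ ≤ c) :
    ⟪y, x⟫_B * ⟪x, y⟫_B ≤ (c : ℂ) • ⟪y, y⟫_B := by
  have h0 : 0 ≤ ⟪(c : ℂ) • y - op ⟪x, y⟫_B • x, (c : ℂ) • y - op ⟪x, y⟫_B • x⟫_B :=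
    ip_self_nonneg _
  have h1 : ⟪y, x⟫_B * ⟪x, x⟫_B * ⟪x, y⟫_B ≤ (c : ℂ) • (⟪y, x⟫_B * ⟪x, y⟫_B) := by
    have h2 : ⟪x, x⟫_B ≤ algebraMap ℝ B c :=
      (IsSelfAdjoint.le_algebraMap_norm_self (star_ip x x)).trans
        (algebraMap_mono B h)
    have h3 := star_left_conjugate_le_conjugate h2 ⟪x, y⟫_B
    rw [star_ip, Algebra.algebraMap_eq_smul_one, mul_smul_comm, mul_one, smul_mul_assoc] at h3
    simpa using h3
  rw [ip_sub_left, ip_sub_right, ip_sub_right] at h0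
  simp only [ip_smul_left, ip_smul_right, ip_op_smul_left, ip_op_smul_right,
    star_ip] at h0
  have h4 : (0 : B) ≤ (c : ℂ) • ((c : ℂ) • ⟪y, y⟫_B - ⟪y, x⟫_B * ⟪x, y⟫_B) := by
    refine h0.trans ?_
    have : (star (c : ℂ)) = c := Complex.conj_ofReal c
    rw [this]
    simp only [smul_sub, smul_mul_assoc]
    have := sub_nonneg.2 h1
    rw [← sub_nonneg]
    convert this using 1
    abel
  have h5 : (0 : B) ≤ c • ((c : ℂ) • ⟪y, y⟫_B - ⟪y, x⟫_B * ⟪x, y⟫_B) := by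
    simpa using h4
  have h6 : c • (⟪y, x⟫_B * ⟪x, y⟫_B) ≤ c • ((c : ℂ) • ⟪y, y⟫_B) := by
    rwa [smul_sub, sub_nonneg] at h5
  exact (smul_le_smul_iff_of_pos_left hc).1 h6

/-- The Cauchy-Schwarz inequality. -/
lemma norm_ip_sq_le (x y : V) : ‖⟪x, y⟫_B‖ ^ 2 ≤ ‖⟪x, x⟫_B‖ * ‖⟪y, y⟫_B‖ := by
  have key : ∀ c : ℝ, ‖⟪x, x⟫_B‖ < c → ‖⟪x, y⟫_B‖ ^ 2 ≤ c * ‖⟪y, y⟫_B‖ := by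
    intro c hc
    have hc0 : 0 < c := (norm_nonneg _).trans_lt hc
    have := ip_mul_ip_le x y hc0 hc.le
    rw [← star_ip x y] at this
    have h2 := CStarAlgebra.norm_le_norm_of_nonneg_of_le (star_mul_self_nonneg _) this
    rwa [CStarRing.norm_star_mul_self, norm_smul, Complex.norm_real, Real.norm_of_nonneg hc0.le,
      ← sq] at h2
  refine ge_of_tendsto (x := nhdsWithin ‖⟪x, x⟫_B‖ (Set.Ioi ‖⟪x, x⟫_B‖))
    (f := fun c => c * ‖⟪y, y⟫_B‖) ?_ ?_
  · exact ((continuous_id.mul continuous_const).tendsto _).mono_left nhdsWithin_le_nhds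
  · filter_upwards [self_mem_nhdsWithin] with c hc using key c hc

lemma norm_ip_le (x y : V) : ‖⟪x, y⟫_B‖ ≤ √‖⟪x, x⟫_B‖ * √‖⟪y, y⟫_B‖ := by
  rw [← Real.sqrt_mul (norm_nonneg _)]
  exact Real.le_sqrt_of_sq_le (norm_ip_sq_le x y)

end SemiHilbert

open SemiHilbert

variable [StarOrderedRing B]

/-- `V` with the seminorm `‖x‖ = ‖⟪x, x⟫‖ ^ (1/2)`. -/
@[nolint unusedArguments]
def WithSeminorm (_B : Type u) (V : Type v) : Type v := V

instance : AddCommGroup (WithSeminorm B V) := inferInstanceAs (AddCommGroup V)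
instance : Module ℂ (WithSeminorm B V) := inferInstanceAs (Module ℂ V)
instance : Module Bᵐᵒᵖ (WithSeminorm B V) := inferInstanceAs (Module Bᵐᵒᵖ V)
instance : SemiHilbert B (WithSeminorm B V) := inferInstanceAs (SemiHilbert B V)

instance : Norm (WithSeminorm B V) := ⟨fun x => √‖⟪x, x⟫_B‖⟩

namespace WithSeminorm

lemma norm_def (x : WithSeminorm B V) : ‖x‖ = √‖⟪x, x⟫_B‖ := rfl

lemma norm_sq (x : WithSeminorm B V) : ‖x‖ ^ 2 = ‖⟪x, x⟫_B‖ :=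
  Real.sq_sqrt (norm_nonneg _)

lemma core : SeminormedSpace.Core ℂ (WithSeminorm B V) where
  norm_nonneg x := Real.sqrt_nonneg _
  norm_smul c x := by
    rw [norm_def, norm_def, ip_smul_left, ip_smul_right, norm_smul, norm_smul, norm_star,
      ← mul_assoc, Real.sqrt_mul (by positivity), Real.sqrt_mul_self (norm_nonneg c)]
  norm_triangle x y := by
    refine abs_le_of_sq_le_sq' ?_ (add_nonneg (Real.sqrt_nonneg _) (Real.sqrt_nonneg _)) |>.2
    rw [norm_sq, ip_add_left, ip_add_right, ip_add_right]
    have h1 := norm_ip_le (B := B) x y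
    have h2 := norm_ip_le (B := B) y x
    rw [← norm_def, ← norm_def] at h1 h2
    have h3 := norm_sq (B := B) x
    have h4 := norm_sq (B := B) y
    calc _ ≤ ‖⟪x, x⟫_B‖ + ‖⟪x, y⟫_B‖ + (‖⟪y, x⟫_B‖ + ‖⟪y, y⟫_B‖) :=
          (norm_add_le _ _).trans (add_le_add (norm_add_le _ _) (norm_add_le _ _))
      _ ≤ _ := by rw [← norm_def, ← norm_def]; nlinarith

instance : SeminormedAddCommGroup (WithSeminorm B V) := SeminormedAddCommGroup.ofCore core

instance : NormedSpace ℂ (WithSeminorm B V) where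
  norm_smul_le c x := (core.norm_smul c x).le

instance : UniformContinuousConstSMul Bᵐᵒᵖ (WithSeminorm B V) where
  uniformContinuous_const_smul b := by
    let f : WithSeminorm B V →+ WithSeminorm B V := DistribSMul.toAddMonoidHom _ b
    refine (AddMonoidHomClass.lipschitz_of_bound f ‖unop b‖ fun x => ?_).uniformContinuous
    change ‖b • x‖ ≤ _
    refine abs_le_of_sq_le_sq' ?_ (by positivity) |>.2
    rw [norm_sq, mul_pow, norm_sq]
    obtain ⟨b, rfl⟩ := op_surjective b
    rw [ip_op_smul_left, ip_op_smul_right, unop_op]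
    calc _ ≤ ‖star b‖ * (‖⟪x, x⟫_B‖ * ‖b‖) :=
          (norm_mul_le _ _).trans (mul_le_mul_of_nonneg_left (norm_mul_le _ _) (norm_nonneg _))
      _ = _ := by rw [norm_star]; ring

lemma norm_ip_le' (x y : WithSeminorm B V) : ‖⟪x, y⟫_B‖ ≤ ‖x‖ * ‖y‖ := norm_ip_le x y

lemma continuous_ip : Continuous fun p : WithSeminorm B V × WithSeminorm B V =>
    ⟪p.1, p.2⟫_B := by
  let f : WithSeminorm B V →L⋆[ℂ] WithSeminorm B V →L[ℂ] B :=
    LinearMap.mkContinuous₂ (LinearMap.mk₂'ₛₗ (starRingEnd ℂ) (RingHom.id ℂ)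
      (fun x y : WithSeminorm B V => ⟪x, y⟫_B) ip_add_left ip_smul_left ip_add_right
      ip_smul_right) 1 (fun x y => by simpa using norm_ip_le' x y)
  change Continuous fun p : WithSeminorm B V × WithSeminorm B V => f p.1 p.2
  fun_prop

end WithSeminorm

/-- The Hilbert module obtained from a semi-inner product `B`-module by dividing out the vectors
of length zero and completing. -/
def HilbertCompletion (B : Type u) (V : Type v) [CStarAlgebra B] [PartialOrder B]
    [StarOrderedRing B] [AddCommGroup V] [Module ℂ V] [Module Bᵐᵒᵖ V] [SemiHilbert B V] : Type v :=
  Completion (WithSeminorm B V)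

namespace HilbertCompletion

instance : NormedAddCommGroup (HilbertCompletion B V) :=
  inferInstanceAs (NormedAddCommGroup (Completion (WithSeminorm B V)))
instance : NormedSpace ℂ (HilbertCompletion B V) :=
  inferInstanceAs (NormedSpace ℂ (Completion (WithSeminorm B V)))
instance : CompleteSpace (HilbertCompletion B V) :=
  inferInstanceAs (CompleteSpace (Completion (WithSeminorm B V)))
instance : Module Bᵐᵒᵖ (HilbertCompletion B V) :=
  inferInstanceAs (Module Bᵐᵒᵖ (Completion (WithSeminorm B V)))
instance : ContinuousConstSMul Bᵐᵒᵖ (HilbertCompletion B V) :=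
  inferInstanceAs (ContinuousConstSMul Bᵐᵒᵖ (Completion (WithSeminorm B V)))

/-- The canonical map of a semi-inner product module into its completion. -/
def of (B : Type u) {V : Type v} [CStarAlgebra B] [PartialOrder B]
    [StarOrderedRing B] [AddCommGroup V] [Module ℂ V] [Module Bᵐᵒᵖ V] [SemiHilbert B V] :
    V →ₗ[ℂ] HilbertCompletion B V :=
  (Completion.toComplL (𝕜 := ℂ) (E := WithSeminorm B V)).toLinearMap

lemma denseRange_of : DenseRange (of B : V → HilbertCompletion B V) :=
  Completion.denseRange_coe (α := WithSeminorm B V)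

lemma of_op_smul (b : Bᵐᵒᵖ) (x : V) : of B (b • x) = b • of B x :=
  Completion.coe_smul (X := WithSeminorm B V) b x

lemma continuous_of : Continuous fun x : WithSeminorm B V => of (V := V) B x :=
  Completion.continuous_coe (α := WithSeminorm B V)

lemma norm_of (x : V) : ‖of B x‖ = √‖⟪x, x⟫_B‖ :=
  Completion.norm_coe (E := WithSeminorm B V) x

/-- Extension of the semi-inner product to the completion by continuity. -/
@[reducible] def innerExt : Inner B (HilbertCompletion B V) :=
  Completion.toInner (𝕜' := B) (E' := WithSeminorm B V)

section Ext

attribute [local instance] innerExt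

lemma ip_of_aux (x y : V) : ⟪of B x, of B y⟫_B = ⟪x, y⟫_B :=
  (Completion.isDenseInducing_coe.prodMap Completion.isDenseInducing_coe).extend_eq
    (WithSeminorm.continuous_ip (B := B) (V := V)) (x, y)

lemma continuous_ip_aux : Continuous fun p : HilbertCompletion B V × HilbertCompletion B V =>
    ⟪p.1, p.2⟫_B := by
  have : Continuous fun p : WithSeminorm B V × WithSeminorm B V =>
      ipHom B (V := WithSeminorm B V) p.1 p.2 := WithSeminorm.continuous_ip
  exact (Completion.isDenseInducing_toCompl (WithSeminorm B V)).extend_Z_bilin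
    (Completion.isDenseInducing_toCompl (WithSeminorm B V)) this

@[fun_prop]
lemma continuous_ip_of {X : Type*} [TopologicalSpace X] {f g : X → HilbertCompletion B V}
    (hf : Continuous f) (hg : Continuous g) : Continuous fun x => ⟪f x, g x⟫_B :=
  continuous_ip_aux.comp (hf.prodMk hg)

lemma ind {p : HilbertCompletion B V → Prop} (hp : IsClosed {x | p x}) (h : ∀ x, p (of B x)) :
    ∀ x, p x :=
  fun x => Completion.induction_on (α := WithSeminorm B V) x hp h

lemma ip_add_right' (x y z : HilbertCompletion B V) : ⟪x, y + z⟫_B = ⟪x, y⟫_B + ⟪x, z⟫_B := by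
  induction x using ind with
  | hp => exact isClosed_eq (by fun_prop) (by fun_prop)
  | h x =>
  induction y using ind with
  | hp => exact isClosed_eq (by fun_prop) (by fun_prop)
  | h y =>
  induction z using ind with
  | hp => exact isClosed_eq (by fun_prop) (by fun_prop)
  | h z => rw [← map_add, ip_of_aux, ip_of_aux, ip_of_aux, ip_add_right]

lemma ip_smul_right' (c : ℂ) (x y : HilbertCompletion B V) : ⟪x, c • y⟫_B = c • ⟪x, y⟫_B := by
  induction x using ind with
  | hp => exact isClosed_eq (by fun_prop) (by fun_prop)
  | h x =>
  induction y using ind with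
  | hp =>
    have h1 : Continuous fun y : HilbertCompletion B V => c • y := continuous_const_smul c
    have h2 : Continuous fun y : HilbertCompletion B V => ⟪of B x, y⟫_B := by fun_prop
    exact isClosed_eq (h2.comp h1) (h2.const_smul c)
  | h y => rw [← map_smul, ip_of_aux, ip_of_aux, ip_smul_right]

lemma ip_op_smul_right' (b : B) (x y : HilbertCompletion B V) :
    ⟪x, op b • y⟫_B = ⟪x, y⟫_B * b := by
  induction x using ind with
  | hp => exact isClosed_eq (by fun_prop) (by fun_prop)
  | h x =>
  induction y using ind with
  | hp =>
    have h1 : Continuous fun y : HilbertCompletion B V => op b • y := continuous_const_smul (op b)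
    have h2 : Continuous fun y : HilbertCompletion B V => ⟪of B x, y⟫_B := by fun_prop
    exact isClosed_eq (h2.comp h1) (h2.mul_const b)
  | h y => rw [← of_op_smul, ip_of_aux, ip_of_aux, ip_op_smul_right]

lemma star_ip' (x y : HilbertCompletion B V) : star ⟪x, y⟫_B = ⟪y, x⟫_B := by
  induction x using ind with
  | hp => exact isClosed_eq (by fun_prop) (by fun_prop)
  | h x =>
  induction y using ind with
  | hp => exact isClosed_eq (by fun_prop) (by fun_prop)
  | h y => rw [ip_of_aux, ip_of_aux, star_ip]

instance : HilbertModule B (HilbertCompletion B V) where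
  toInner := innerExt
  ip_add_right := ip_add_right'
  ip_smul_right := ip_smul_right'
  ip_op_smul_right := ip_op_smul_right'
  star_ip := star_ip'
  ip_self_nonneg x := by
    induction x using ind with
    | hp => exact isClosed_le continuous_const (by fun_prop)
    | h x => rw [ip_of_aux]; exact ip_self_nonneg x
  norm_eq x := by
    induction x using ind with
    | hp => exact isClosed_eq (by fun_prop) (by fun_prop)
    | h x => rw [ip_of_aux, norm_of]

end Ext

lemma ip_of (x y : V) : ⟪of B x, of B y⟫_B = ⟪x, y⟫_B := ip_of_aux x y

end HilbertCompletion
end Semi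

open SemiHilbert

/-! ### Adjointable operators -/

namespace HilbertModule

variable {B : Type u} {E : Type v} [CStarAlgebra B] [PartialOrder B]
  [NormedAddCommGroup E] [NormedSpace ℂ E] [CompleteSpace E] [Module Bᵐᵒᵖ E] [HilbertModule B E]

lemma norm_sq_eq (x : E) : ‖x‖ ^ 2 = ‖⟪x, x⟫_B‖ := by
  rw [norm_eq (B := B), Real.sq_sqrt (norm_nonneg _)]

lemma eq_zero_of_ip_self {x : E} (h : ⟪x, x⟫_B = 0) : x = 0 := by
  rw [← norm_eq_zero, norm_eq (B := B), h, norm_zero, Real.sqrt_zero]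

lemma ext_ip {x y : E} (h : ∀ z : E, ⟪z, x⟫_B = ⟪z, y⟫_B) : x = y := by
  refine sub_eq_zero.1 (eq_zero_of_ip_self (B := B) ?_)
  rw [ip_sub_right, h, sub_self]

instance : SMulCommClass Bᵐᵒᵖ ℂ E where
  smul_comm b c x := ext_ip (B := B) fun z => by
    obtain ⟨b, rfl⟩ := op_surjective b
    rw [ip_op_smul_right, ip_smul_right, ip_smul_right, ip_op_smul_right, smul_mul_assoc]

variable [StarOrderedRing B]

lemma norm_ip_le (x y : E) : ‖⟪x, y⟫_B‖ ≤ ‖x‖ * ‖y‖ := by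
  rw [norm_eq (B := B) x, norm_eq (B := B) y]
  exact SemiHilbert.norm_ip_le x y

variable (B E) in
/-- The inner product as a continuous sesquilinear map. -/
def ipL : E →L⋆[ℂ] E →L[ℂ] B :=
  LinearMap.mkContinuous₂ (LinearMap.mk₂'ₛₗ (starRingEnd ℂ) (RingHom.id ℂ)
    (fun x y : E => ⟪x, y⟫_B) ip_add_left ip_smul_left ip_add_right ip_smul_right) 1
    (fun x y => by simpa using norm_ip_le x y)

@[fun_prop]
lemma continuous_ip {X : Type*} [TopologicalSpace X] {f g : X → E}
    (hf : Continuous f) (hg : Continuous g) : Continuous fun x => ⟪f x, g x⟫_B := by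
  change Continuous fun x => ipL B E (f x) (g x)
  fun_prop

lemma norm_op_smul_le (b : B) (x : E) : ‖op b • x‖ ≤ ‖b‖ * ‖x‖ := by
  refine abs_le_of_sq_le_sq' ?_ (by positivity) |>.2
  rw [mul_pow, norm_sq_eq (B := B) x, norm_sq_eq (B := B), ip_op_smul_left, ip_op_smul_right]
  calc _ ≤ ‖star b‖ * (‖⟪x, x⟫_B‖ * ‖b‖) :=
        (norm_mul_le _ _).trans (mul_le_mul_of_nonneg_left (norm_mul_le _ _) (norm_nonneg _))
    _ = _ := by rw [norm_star]; ring

instance : ContinuousConstSMul Bᵐᵒᵖ E where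
  continuous_const_smul b :=
    AddMonoidHomClass.continuous_of_bound (DistribSMul.toAddMonoidHom E b) ‖unop b‖
      fun x => norm_op_smul_le (unop b) x

end HilbertModule

open HilbertModule

section Adj

/-- The algebra of adjointable operators, as a subalgebra of the bounded operators. (A map with an
adjoint is automatically linear and bounded.) -/
def adjSubalgebra (B : Type u) (E : Type v) [CStarAlgebra B] [PartialOrder B]
    [NormedAddCommGroup E] [NormedSpace ℂ E] [CompleteSpace E] [Module Bᵐᵒᵖ E]
    [HilbertModule B E] : Subalgebra ℂ (E →L[ℂ] E) where
  carrier := {a | ∃ a' : E →L[ℂ] E, ∀ x y : E, ⟪a x, y⟫_B = ⟪x, a' y⟫_B}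
  mul_mem' := by
    rintro a b ⟨a', ha⟩ ⟨b', hb⟩
    exact ⟨b' * a', fun x y => by simp [ha, hb]⟩
  add_mem' := by
    rintro a b ⟨a', ha⟩ ⟨b', hb⟩
    exact ⟨a' + b', fun x y => by simp [ha, hb, ip_add_left, ip_add_right]⟩
  algebraMap_mem' c := ⟨algebraMap ℂ _ (star c), fun x y => by
    simp [Algebra.algebraMap_eq_smul_one, ip_smul_left, ip_smul_right]⟩

/-- `ℬᵃ(E)`, the `C⋆`-algebra of adjointable operators on the Hilbert `B`-module `E`. -/
def Adj (B : Type u) (E : Type v) [CStarAlgebra B] [PartialOrder B]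
    [NormedAddCommGroup E] [NormedSpace ℂ E] [CompleteSpace E] [Module Bᵐᵒᵖ E]
    [HilbertModule B E] : Type v := adjSubalgebra B E

variable {B : Type u} {E : Type v} [CStarAlgebra B] [PartialOrder B]
  [NormedAddCommGroup E] [NormedSpace ℂ E] [CompleteSpace E] [Module Bᵐᵒᵖ E] [HilbertModule B E]

namespace Adj

instance : NormedRing (Adj B E) := inferInstanceAs (NormedRing (adjSubalgebra B E))
instance : NormedAlgebra ℂ (Adj B E) := inferInstanceAs (NormedAlgebra ℂ (adjSubalgebra B E))

instance : CoeFun (Adj B E) fun _ => E → E := ⟨fun a => a.1⟩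

lemma ext' {a b : Adj B E} (h : ∀ x, a x = b x) : a = b :=
  Subtype.ext (ContinuousLinearMap.ext h)

/-- Constructor from a pair of mutually adjoint operators. -/
def mk' (a a' : E →L[ℂ] E) (h : ∀ x y : E, ⟪a x, y⟫_B = ⟪x, a' y⟫_B) : Adj B E := ⟨a, a', h⟩

@[simp] lemma mk'_apply (a a' : E →L[ℂ] E) (h : ∀ x y : E, ⟪a x, y⟫_B = ⟪x, a' y⟫_B) (x : E) :
    mk' a a' h x = a x := rfl

/-- The adjoint operator. -/
instance : Star (Adj B E) where
  star a := ⟨a.2.choose, a.1, fun x y => by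
    rw [← star_ip, ← a.2.choose_spec, star_ip]⟩

lemma ip_star_right (a : Adj B E) (x y : E) : ⟪x, star a y⟫_B = ⟪a x, y⟫_B :=
  (a.2.choose_spec x y).symm

lemma ip_star_left (a : Adj B E) (x y : E) : ⟪star a x, y⟫_B = ⟪x, a y⟫_B := by
  rw [← star_ip, ip_star_right, star_ip]

lemma eq_star {a b : Adj B E} (h : ∀ x y : E, ⟪b x, y⟫_B = ⟪x, a y⟫_B) : a = star b :=
  ext' fun y => ext_ip (B := B) fun x => by rw [ip_star_right, h]

@[simp] lemma mul_apply (a b : Adj B E) (x : E) : (a * b) x = a (b x) := rfl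
@[simp] lemma add_apply (a b : Adj B E) (x : E) : (a + b) x = a x + b x := rfl
@[simp] lemma smul_apply (c : ℂ) (a : Adj B E) (x : E) : (c • a) x = c • a x := rfl
@[simp] lemma one_apply (x : E) : (1 : Adj B E) x = x := rfl
@[simp] lemma sub_apply (a b : Adj B E) (x : E) : (a - b) x = a x - b x := rfl
@[simp] lemma neg_apply (a : Adj B E) (x : E) : (-a) x = -a x := rfl
@[simp] lemma zero_apply (x : E) : (0 : Adj B E) x = 0 := rfl

lemma sum_apply {ι : Type*} (s : Finset ι) (f : ι → Adj B E) (x : E) :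
    (∑ i ∈ s, f i) x = ∑ i ∈ s, f i x :=
  map_sum (AddMonoidHom.mk' (fun a : Adj B E => a x) fun _ _ => rfl) f s

lemma map_op_smul (a : Adj B E) (b : B) (x : E) : a (op b • x) = op b • a x :=
  ext_ip (B := B) fun z => by
    rw [ip_op_smul_right, ← ip_star_left, ← ip_star_left, ip_op_smul_right]

instance : StarRing (Adj B E) where
  star_involutive a := (eq_star fun x y => ip_star_left a x y).symm
  star_mul a b := (eq_star fun x y => by simp [ip_star_right]).symm
  star_add a b := (eq_star fun x y => by simp [ip_star_right, ip_add_left, ip_add_right]).symm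

instance : StarModule ℂ (Adj B E) where
  star_smul c a := (eq_star fun x y => by simp [ip_star_right, ip_smul_left, ip_smul_right]).symm

variable [StarOrderedRing B]

lemma norm_apply_le (a : Adj B E) (x : E) : ‖a x‖ ≤ ‖a‖ * ‖x‖ := a.1.le_opNorm x

instance : CStarRing (Adj B E) where
  norm_mul_self_le a := by
    rw [← sq]
    have key : ‖a‖ ≤ √‖star a * a‖ := by
      refine ContinuousLinearMap.opNorm_le_bound _ (Real.sqrt_nonneg _) fun x => ?_
      refine abs_le_of_sq_le_sq' ?_ (by positivity) |>.2
      change ‖a x‖ ^ 2 ≤ _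
      rw [mul_pow, Real.sq_sqrt (norm_nonneg (star a * a)), norm_sq_eq (B := B)]
      rw [← ip_star_right]
      refine (HilbertModule.norm_ip_le _ _).trans ?_
      calc ‖x‖ * ‖star a (a x)‖ ≤ ‖x‖ * (‖star a * a‖ * ‖x‖) :=
            mul_le_mul_of_nonneg_left (norm_apply_le (star a * a) x) (norm_nonneg _)
        _ = _ := by ring
    calc ‖a‖ ^ 2 ≤ (√‖star a * a‖) ^ 2 := by gcongr
      _ = _ := Real.sq_sqrt (norm_nonneg _)

instance : CompleteSpace (Adj B E) := by
  refine IsClosed.completeSpace_coe (s := (adjSubalgebra B E : Set (E →L[ℂ] E))) (hs := ?_)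
  refine isClosed_of_closure_subset fun a ha => ?_
  obtain ⟨f, hf, hfa⟩ := mem_closure_iff_seq_limit.1 ha
  let g : ℕ → Adj B E := fun n => ⟨f n, hf n⟩
  have hc : CauchySeq fun n => (star (g n)).1 := by
    have h0 : CauchySeq f := hfa.cauchySeq
    rw [Metric.cauchySeq_iff] at h0 ⊢
    intro ε hε
    obtain ⟨N, hN⟩ := h0 ε hε
    refine ⟨N, fun m hm n hn => ?_⟩
    have := hN m hm n hn
    rw [dist_eq_norm] at this ⊢
    have e : ‖(star (g m)).1 - (star (g n)).1‖ = ‖star (g m - g n)‖ := by rw [star_sub]; rfl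
    rw [e]
    exact (norm_star (g m - g n)).trans_lt this
  obtain ⟨a', ha'⟩ := cauchySeq_tendsto_of_complete hc
  refine ⟨a', fun x y => ?_⟩
  have h1 : Filter.Tendsto (fun n => ⟪f n x, y⟫_B) Filter.atTop (nhds ⟪a x, y⟫_B) :=
    ((show Continuous fun t : E →L[ℂ] E => ⟪t x, y⟫_B by fun_prop).tendsto a).comp hfa
  have h2 : Filter.Tendsto (fun n => ⟪x, (star (g n)).1 y⟫_B) Filter.atTop
      (nhds ⟪x, a' y⟫_B) :=
    ((show Continuous fun t : E →L[ℂ] E => ⟪x, t y⟫_B by fun_prop).tendsto a').comp ha'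
  refine tendsto_nhds_unique h1 (h2.congr fun n => ?_)
  exact ip_star_right (g n) x y

instance : CStarAlgebra (Adj B E) where

/-- The usual order of the `C⋆`-algebra `ℬᵃ(E)`. -/
instance : PartialOrder (Adj B E) := CStarAlgebra.spectralOrder _
instance : StarOrderedRing (Adj B E) := CStarAlgebra.spectralOrderedRing _

end Adj

end Adj

/-! ### Positivity -/

section Pos

/-- A criterion for positivity in a `C⋆`-algebra through the cube of the negative part. -/
lemma nonneg_of_cube {A : Type*} [CStarAlgebra A] [PartialOrder A] [StarOrderedRing A] {m : A}
    (hm : IsSelfAdjoint m)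
    (h : ∀ n : A, IsSelfAdjoint n → 0 ≤ n * n * n → n * m * n = -(n * n * n) → n * n * n = 0) :
    0 ≤ m := by
  have hn : 0 ≤ m⁻ := CFC.negPart_nonneg m
  have hs : IsSelfAdjoint m⁻ := hn.isSelfAdjoint
  have h1 : m⁻ * m * m⁻ = -(m⁻ * m⁻ * m⁻) := by
    have h2 : m⁻ * (m⁺ - m⁻) * m⁻ = -(m⁻ * m⁻ * m⁻) := by
      rw [mul_sub, CFC.negPart_mul_posPart, zero_sub, neg_mul]
    rwa [CFC.posPart_sub_negPart m hm] at h2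
  have h2 : 0 ≤ m⁻ * m⁻ * m⁻ := by
    simpa [hs.star_eq] using star_left_conjugate_nonneg hn m⁻
  have h3 := h m⁻ hs h2 h1
  have h4 : m⁻ * m⁻ = 0 := by
    rw [← CStarRing.star_mul_self_eq_zero_iff, star_mul, hs.star_eq, ← mul_assoc, h3, zero_mul]
  have h5 : m⁻ = 0 := by
    rwa [← CStarRing.star_mul_self_eq_zero_iff, hs.star_eq]
  exact (CFC.negPart_eq_zero_iff m hm).1 h5

lemma exists_eq_star_mul {A : Type*} [CStarAlgebra A] [PartialOrder A] [StarOrderedRing A] {m : A}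
    (h : 0 ≤ m) : ∃ c, m = star c * c := CStarAlgebra.nonneg_iff_eq_star_mul_self.1 h

variable {B : Type u} {E : Type v} [CStarAlgebra B] [PartialOrder B] [StarOrderedRing B]
  [NormedAddCommGroup E] [NormedSpace ℂ E] [CompleteSpace E] [Module Bᵐᵒᵖ E] [HilbertModule B E]

lemma Adj.nonneg_of_ip {a : Adj B E} (ha : IsSelfAdjoint a) (h : ∀ x : E, 0 ≤ ⟪x, a x⟫_B) :
    0 ≤ a := by
  refine nonneg_of_cube ha fun n hn h0 h1 => ?_
  obtain ⟨c, hc⟩ := exists_eq_star_mul h0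
  have key : ∀ x : E, c x = 0 := fun x => by
    refine eq_zero_of_ip_self (B := B) (le_antisymm ?_ (ip_self_nonneg _))
    have h2 : ⟪c x, c x⟫_B = -⟪n x, a (n x)⟫_B := by
      have h3 : ⟪n x, a (n x)⟫_B = ⟪x, (n * a * n) x⟫_B := by
        rw [Adj.mul_apply, Adj.mul_apply, ← Adj.ip_star_left n, hn.star_eq]
      rw [h3, h1, ← Adj.ip_star_right, ← Adj.mul_apply, ← hc, Adj.neg_apply, ip_neg_right, neg_neg]
    rw [h2, neg_nonpos]
    exact h _
  have : c = 0 := Adj.ext' key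
  rw [hc, this, mul_zero]

/-- The Gram matrix of finitely many vectors is positive. -/
lemma gram_nonneg {ι : Type*} [Fintype ι] [DecidableEq ι] (x : ι → E) :
    0 ≤ (CStarMatrix.ofMatrix (fun i j => ⟪x i, x j⟫_B) : CStarMatrix ι ι B) := by
  refine nonneg_of_cube ?_ fun n hn h0 h1 => ?_
  · ext i j
    exact star_ip (x j) (x i)
  obtain ⟨c, hc⟩ := exists_eq_star_mul h0
  have key : ∀ k i, c k i = 0 := by
    intro k i
    let y : E := ∑ l, op (n l i) • x l
    have h2 : (n * (CStarMatrix.ofMatrix (fun i j => ⟪x i, x j⟫_B) : CStarMatrix ι ι B) * n) i i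
        = ⟪y, y⟫_B := by
      have hs : ∀ l, star (n l i) = n i l := fun l => CStarMatrix.star_apply_of_isSelfAdjoint hn
      simp only [CStarMatrix.mul_apply, y, ip_sum_left, ip_sum_right, ip_op_smul_left,
        ip_op_smul_right, Finset.sum_mul, hs, mul_assoc]
      rfl
    have h3 : ∑ k, star (c k i) * c k i = -⟪y, y⟫_B := by
      have h5 : (n * n * n) i i = -⟪y, y⟫_B := by
        rw [← h2, h1]; exact (neg_neg ((n * n * n) i i)).symm
      rw [← h5, hc, CStarMatrix.mul_apply]
      rfl
    have h4 : ∑ k, star (c k i) * c k i = 0 :=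
      le_antisymm (by rw [h3, neg_nonpos]; exact ip_self_nonneg y)
        (Finset.sum_nonneg fun _ _ => star_mul_self_nonneg _)
    have h5 := (Finset.sum_eq_zero_iff_of_nonneg
      (fun _ _ => star_mul_self_nonneg _)).1 h4 k (Finset.mem_univ k)
    exact (CStarRing.star_mul_self_eq_zero_iff _).1 h5
  have : c = 0 := by ext k i; exact key k i
  rw [hc, this, mul_zero]

end Pos


/-! ### Rank-one operators and compacts -/

section RankOne

variable {B : Type u} {E : Type v} [CStarAlgebra B] [PartialOrder B] [StarOrderedRing B]
  [NormedAddCommGroup E] [NormedSpace ℂ E] [CompleteSpace E] [Module Bᵐᵒᵖ E] [HilbertModule B E]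

lemma op_smul_complex (c : ℂ) (b : B) (x : E) : op (c • b) • x = c • (op b • x) :=
  ext_ip (B := B) fun z => by
    rw [ip_op_smul_right, ip_smul_right, ip_op_smul_right, mul_smul_comm]

/-- The underlying bounded operator of `x y^*`. -/
def rankOneCLM (B : Type u) {E : Type v} [CStarAlgebra B] [PartialOrder B] [StarOrderedRing B]
    [NormedAddCommGroup E] [NormedSpace ℂ E] [CompleteSpace E] [Module Bᵐᵒᵖ E]
    [HilbertModule B E] (x y : E) : E →L[ℂ] E :=
  LinearMap.mkContinuous
    { toFun := fun z => op ⟪y, z⟫_B • x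
      map_add' := fun z w => by rw [ip_add_right, op_add, add_smul]
      map_smul' := fun c z => by rw [ip_smul_right, op_smul_complex, RingHom.id_apply] }
    (‖y‖ * ‖x‖) fun z => by
      calc ‖op ⟪y, z⟫_B • x‖ ≤ ‖⟪y, z⟫_B‖ * ‖x‖ := norm_op_smul_le _ _
        _ ≤ (‖y‖ * ‖z‖) * ‖x‖ := by gcongr; exact HilbertModule.norm_ip_le y z
        _ = _ := by ring

/-- The rank-one operator `x y^* : z ↦ x ⟪y, z⟫`. -/
def rankOne (B : Type u) {E : Type v} [CStarAlgebra B] [PartialOrder B] [StarOrderedRing B]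
    [NormedAddCommGroup E] [NormedSpace ℂ E] [CompleteSpace E] [Module Bᵐᵒᵖ E]
    [HilbertModule B E] (x y : E) : Adj B E :=
  Adj.mk' (rankOneCLM B x y) (rankOneCLM B y x) fun z w => by
    change ⟪op ⟪y, z⟫_B • x, w⟫_B = ⟪z, op ⟪x, w⟫_B • y⟫_B
    rw [ip_op_smul_left, ip_op_smul_right, star_ip]

lemma rankOne_apply (x y z : E) : rankOne B x y z = op ⟪y, z⟫_B • x := rfl

lemma star_rankOne (x y : E) : star (rankOne B x y) = rankOne B y x :=
  (Adj.eq_star fun z w => by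
    rw [rankOne_apply, rankOne_apply, ip_op_smul_left, ip_op_smul_right, star_ip]).symm

lemma rankOne_add_left (x x' y : E) : rankOne B (x + x') y = rankOne B x y + rankOne B x' y :=
  Adj.ext' fun z => by simp [rankOne_apply]

lemma rankOne_add_right (x y y' : E) : rankOne B x (y + y') = rankOne B x y + rankOne B x y' :=
  Adj.ext' fun z => by simp [rankOne_apply, ip_add_left, add_smul]

lemma rankOne_smul_left (c : ℂ) (x y : E) : rankOne B (c • x) y = c • rankOne B x y :=
  Adj.ext' fun z => by simp [rankOne_apply, smul_comm]

lemma rankOne_smul_right (c : ℂ) (x y : E) : rankOne B x (c • y) = star c • rankOne B x y :=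
  Adj.ext' fun z => by
    rw [rankOne_apply, ip_smul_left, op_smul_complex, Adj.smul_apply, rankOne_apply]

lemma rankOne_op_smul (b : B) (x y : E) :
    rankOne B (op b • x) y = rankOne B x (op (star b) • y) :=
  Adj.ext' fun z => by
    rw [rankOne_apply, rankOne_apply, ip_op_smul_left, star_star, op_mul, mul_smul]

lemma mul_rankOne (a : Adj B E) (x y : E) : a * rankOne B x y = rankOne B (a x) y :=
  Adj.ext' fun z => by rw [Adj.mul_apply, rankOne_apply, Adj.map_op_smul, rankOne_apply]

lemma rankOne_mul (a : Adj B E) (x y : E) : rankOne B x y * a = rankOne B x (star a y) :=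
  Adj.ext' fun z => by rw [Adj.mul_apply, rankOne_apply, rankOne_apply, Adj.ip_star_left]

lemma rankOne_self_nonneg (x : E) : 0 ≤ rankOne B x x :=
  Adj.nonneg_of_ip (star_rankOne x x) fun z => by
    rw [rankOne_apply, ip_op_smul_right, ← star_ip x z]
    exact star_mul_self_nonneg _

lemma norm_rankOne_self (x : E) : ‖rankOne B x x‖ = ‖x‖ ^ 2 := by
  apply le_antisymm
  · rw [sq]
    exact ContinuousLinearMap.opNorm_le_bound _ (by positivity) fun z => by
      refine (norm_op_smul_le (B := B) _ _).trans ?_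
      calc ‖⟪x, z⟫_B‖ * ‖x‖ ≤ (‖x‖ * ‖z‖) * ‖x‖ := by
            gcongr; exact HilbertModule.norm_ip_le x z
        _ = _ := by ring
  · by_cases hx : ‖x‖ = 0
    · rw [hx]; simp
    have h1 : ⟪x, rankOne B x x x⟫_B = star ⟪x, x⟫_B * ⟪x, x⟫_B := by
      rw [rankOne_apply, ip_op_smul_right, star_ip]
    have h2 : ‖⟪x, rankOne B x x x⟫_B‖ ≤ ‖x‖ * (‖rankOne B x x‖ * ‖x‖) :=
      (HilbertModule.norm_ip_le _ _).trans
        (mul_le_mul_of_nonneg_left (Adj.norm_apply_le _ _) (norm_nonneg _))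
    rw [h1, CStarRing.norm_star_mul_self, ← norm_sq_eq] at h2
    have h3 : 0 < ‖x‖ ^ 2 := by positivity
    refine le_of_mul_le_mul_right ?_ h3
    linarith

variable (B E) in
/-- `𝒦(E)`, the closed linear span of the rank-one operators. -/
def compacts : Submodule ℂ (Adj B E) :=
  (Submodule.span ℂ {a | ∃ x y : E, a = rankOne B x y}).topologicalClosure

/-- A unital endomorphism of `ℬᵃ(E)` is strict if its restriction to the compacts acts
nondegenerately on `E`. -/
def IsStrictEnd (φ : Adj B E →⋆ₐ[ℂ] Adj B E) : Prop :=
  (Submodule.span ℂ {z : E | ∃ a ∈ compacts B E, ∃ x : E, z = φ a x}).topologicalClosure = ⊤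

/-- The embedding `b ↦ ξ b ξ^*` of `B` into `ℬᵃ(E)` for a unit vector `ξ`. -/
def vecEmbedding (ξ : E) (hξ : ⟪ξ, ξ⟫_B = 1) : B →⋆ₙₐ[ℂ] Adj B E where
  toFun b := rankOne B (op b • ξ) ξ
  map_zero' := Adj.ext' fun z => by simp [rankOne_apply]
  map_add' b c := by rw [op_add, add_smul, rankOne_add_left]
  map_smul' c b := by rw [op_smul_complex, rankOne_smul_left]; rfl
  map_mul' b c := by
    rw [mul_rankOne, rankOne_apply, ip_op_smul_right, hξ, one_mul, op_mul, mul_smul]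
  map_star' b := by rw [star_rankOne, rankOne_op_smul, star_star]

end RankOne

/-! ### The internal tensor product -/

namespace HilbertCompletion

variable {B : Type u} {V : Type v} [CStarAlgebra B] [PartialOrder B] [StarOrderedRing B]
  [AddCommGroup V] [Module ℂ V] [Module Bᵐᵒᵖ V] [SemiHilbert B V]
  {G : Type w} [NormedAddCommGroup G] [NormedSpace ℂ G] [CompleteSpace G]

lemma norm_of_sq (x : V) : ‖of B x‖ ^ 2 = ‖⟪x, x⟫_B‖ := by
  rw [norm_of, Real.sq_sqrt (norm_nonneg _)]

/-- The continuous extension of a bounded linear map to the completion. -/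
def lift (f : V →ₗ[ℂ] G) : HilbertCompletion B V →L[ℂ] G := f.extendOfNorm (of B)

lemma lift_of (f : V →ₗ[ℂ] G) {C : ℝ} (hC : ∀ x, ‖f x‖ ≤ C * ‖of B x‖) (x : V) :
    lift (B := B) f (of B x) = f x :=
  LinearMap.extendOfNorm_eq denseRange_of ⟨C, hC⟩ x

end HilbertCompletion

section Tensor

/-- The algebraic tensor product over `ℂ` of a right `A`-module `E` with a right `B`-module `F`
that carries a left action `π` of `A`; its semi-inner product is given below. -/
@[nolint unusedArguments]
def PreTensor {A : Type*} {B : Type u} {F : Type v} [CStarAlgebra A] [CStarAlgebra B]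
    [PartialOrder B] [NormedAddCommGroup F] [NormedSpace ℂ F] [CompleteSpace F] [Module Bᵐᵒᵖ F]
    [HilbertModule B F] (E : Type w) [AddCommGroup E] [Module ℂ E] (_π : A →⋆ₐ[ℂ] Adj B F) :
    Type (max v w) := E ⊗[ℂ] F

variable {A : Type*} {B : Type u} {F : Type v} {E : Type w}
  [CStarAlgebra A] [PartialOrder A] [StarOrderedRing A]
  [CStarAlgebra B] [PartialOrder B] [StarOrderedRing B]
  [NormedAddCommGroup F] [NormedSpace ℂ F] [CompleteSpace F] [Module Bᵐᵒᵖ F] [HilbertModule B F]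
  [NormedAddCommGroup E] [NormedSpace ℂ E] [CompleteSpace E] [Module Aᵐᵒᵖ E] [HilbertModule A E]
  (π : A →⋆ₐ[ℂ] Adj B F)

namespace PreTensor

instance : AddCommGroup (PreTensor E π) := inferInstanceAs (AddCommGroup (E ⊗[ℂ] F))
instance : Module ℂ (PreTensor E π) := inferInstanceAs (Module ℂ (E ⊗[ℂ] F))

/-- The right action `(x ⊗ y) b = x ⊗ (y b)`. -/
instance : Module Bᵐᵒᵖ (PreTensor E π) :=
  Module.compHom (E ⊗[ℂ] F) ((Module.End.lTensorAlgHom ℂ F E).toRingHom.comp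
    (Module.toModuleEnd ℂ (S := Bᵐᵒᵖ) F))

/-- The elementary tensor `x ⊗ y`. -/
def tmul (x : E) (y : F) : PreTensor E π := x ⊗ₜ[ℂ] y

variable {π}

lemma op_smul_tmul (b : Bᵐᵒᵖ) (x : E) (y : F) : b • tmul π x y = tmul π x (b • y) := rfl

lemma ind {p : PreTensor E π → Prop} (h0 : p 0) (h1 : ∀ x y, p (tmul π x y))
    (h2 : ∀ z w, p z → p w → p (z + w)) (z : PreTensor E π) : p z :=
  TensorProduct.induction_on (motive := p) z h0 h1 h2

/-- The linear functional `z ↦ ⟪x ⊗ y, z⟫`. -/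
def pairing (x : E) (y : F) : PreTensor E π →ₗ[ℂ] B :=
  TensorProduct.lift (LinearMap.mk₂ ℂ (fun x' y' => ⟪y, π ⟪x, x'⟫_A y'⟫_B)
    (fun x₁ x₂ y' => by rw [ip_add_right, map_add, Adj.add_apply, ip_add_right])
    (fun c x' y' => by rw [ip_smul_right, map_smul, Adj.smul_apply, ip_smul_right])
    (fun x' y₁ y₂ => by rw [map_add, ip_add_right])
    (fun c x' y' => by rw [map_smul, ip_smul_right]))

lemma pairing_tmul (x x' : E) (y y' : F) :
    pairing x y (tmul π x' y') = ⟪y, π ⟪x, x'⟫_A y'⟫_B := rfl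

lemma ext_lin {G : Type*} [AddCommGroup G] [Module ℂ G] {f g : PreTensor E π →ₗ[ℂ] G}
    (h : ∀ x y, f (tmul π x y) = g (tmul π x y)) : f = g :=
  TensorProduct.ext' h

/-- The semi-inner product in additive form. -/
def ipAux : PreTensor E π →+ (PreTensor E π →ₗ[ℂ] B) :=
  TensorProduct.liftAddHom (R := ℂ) (M := E) (N := F)
    (AddMonoidHom.mk' (fun x => AddMonoidHom.mk' (fun y => pairing x y)
      (fun y₁ y₂ => ext_lin fun x' y' => by
        simp only [LinearMap.add_apply, pairing_tmul, ip_add_left]))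
      (fun x₁ x₂ => by
        ext y : 1
        refine ext_lin fun x' y' => ?_
        simp only [AddMonoidHom.mk'_apply, AddMonoidHom.add_apply, LinearMap.add_apply,
          pairing_tmul, ip_add_left, map_add, Adj.add_apply, ip_add_right]))
    (fun c x y => ext_lin fun x' y' => by
      simp only [AddMonoidHom.mk'_apply, pairing_tmul, ip_smul_left, map_smul, Adj.smul_apply,
        ip_smul_right])

/-- `⟪x ⊗ y, x' ⊗ y'⟫ = ⟪y, π(⟪x, x'⟫) y'⟫`. -/
@[reducible] def innerTensor : Inner B (PreTensor E π) where
  inner z w := ipAux z w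

section Inner

attribute [local instance] innerTensor

lemma ip_def (z w : PreTensor E π) : ⟪z, w⟫_B = ipAux z w := rfl

lemma ip_tmul_aux (x x' : E) (y y' : F) :
    ⟪tmul π x y, tmul π x' y'⟫_B = ⟪y, π ⟪x, x'⟫_A y'⟫_B := rfl

lemma ip_sum_aux {ι : Type*} [Fintype ι] (x : ι → E) (y : ι → F) :
    ⟪∑ i, tmul π (x i) (y i), ∑ i, tmul π (x i) (y i)⟫_B
      = ∑ i, ∑ j, ⟪y i, π ⟪x i, x j⟫_A (y j)⟫_B := by
  simp only [ip_def, map_sum, LinearMap.sum_apply]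
  rw [Finset.sum_comm]
  rfl

lemma ip_self_nonneg' (z : PreTensor E π) : 0 ≤ ⟪z, z⟫_B := by
  classical
  obtain ⟨S, hS⟩ := TensorProduct.exists_finset (R := ℂ) (M := E) (N := F) z
  have hz : z = ∑ i : S, tmul π i.1.1 i.1.2 := by
    rw [hS]; exact (Finset.sum_coe_sort S fun i => tmul π i.1 i.2).symm
  obtain ⟨c, hc⟩ := exists_eq_star_mul (gram_nonneg (B := A) (fun i : S => i.1.1))
  have hg : ∀ i j : S, ⟪i.1.1, j.1.1⟫_A = ∑ k, star (c k i) * c k j := fun i j => by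
    have := congrArg (fun m : CStarMatrix S S A => m i j) hc
    rw [CStarMatrix.mul_apply] at this
    exact this
  rw [hz, ip_sum_aux]
  have : ∑ i : S, ∑ j : S, ⟪i.1.2, π ⟪i.1.1, j.1.1⟫_A j.1.2⟫_B
      = ∑ k, ⟪∑ i : S, π (c k i) i.1.2, ∑ i : S, π (c k i) i.1.2⟫_B := by
    simp only [ip_sum_left, ip_sum_right]
    have e : ∀ i j k : S, ⟪π (c k i) i.1.2, π (c k j) j.1.2⟫_B
        = ⟪i.1.2, π (star (c k i) * c k j) j.1.2⟫_B := fun i j k => by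
      rw [map_mul, Adj.mul_apply, map_star, Adj.ip_star_right]
    have e2 : ∀ i j : S, ⟪i.1.2, π ⟪i.1.1, j.1.1⟫_A j.1.2⟫_B
        = ∑ k, ⟪π (c k i) i.1.2, π (c k j) j.1.2⟫_B := fun i j => by
      rw [hg, map_sum, Finset.sum_congr rfl fun k _ => e i j k, ← ip_sum_right]
      congr 1
      exact Adj.sum_apply _ _ _
    simp only [e2]
    rw [Finset.sum_comm_cycle]
    refine Finset.sum_congr rfl fun k _ => Finset.sum_comm
  rw [this]
  exact Finset.sum_nonneg fun k _ => ip_self_nonneg _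

instance : SemiHilbert B (PreTensor E π) where
  toInner := innerTensor
  ip_add_right z w w' := map_add (ipAux z) w w'
  ip_smul_right c z w := map_smul (ipAux z) c w
  ip_op_smul_right b z w := by
    induction z using ind with
    | h0 => simp only [ip_def, map_zero, LinearMap.zero_apply, zero_mul]
    | h2 z z' h h' => 
      simp only [ip_def, map_add, LinearMap.add_apply, add_mul] at h h' ⊢
      rw [h, h']
    | h1 x y =>
      induction w using ind with
      | h0 => simp only [ip_def, smul_zero, map_zero, zero_mul]
      | h2 w w' h h' =>
        simp only [ip_def, map_add, add_mul, smul_add] at h h' ⊢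
        rw [h, h']
      | h1 x' y' => rw [op_smul_tmul, ip_tmul_aux, ip_tmul_aux, Adj.map_op_smul, ip_op_smul_right]
  star_ip z w := by
    induction z using ind with
    | h0 => simp only [ip_def, map_zero, LinearMap.zero_apply, star_zero]
    | h2 z z' h h' => 
      simp only [ip_def, map_add, LinearMap.add_apply, star_add] at h h' ⊢
      rw [h, h']
    | h1 x y =>
      induction w using ind with
      | h0 => simp only [ip_def, map_zero, LinearMap.zero_apply, star_zero]
      | h2 w w' h h' =>
        simp only [ip_def, map_add, LinearMap.add_apply, star_add] at h h' ⊢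
        rw [h, h']
      | h1 x' y' =>
        rw [ip_tmul_aux, ip_tmul_aux, star_ip, ← Adj.ip_star_right, ← map_star, star_ip]
  ip_self_nonneg := ip_self_nonneg'

end Inner

lemma ip_tmul (x x' : E) (y y' : F) :
    ⟪tmul π x y, tmul π x' y'⟫_B = ⟪y, π ⟪x, x'⟫_A y'⟫_B := rfl

/-- `a ⊗ id` on the algebraic tensor product. -/
def map (a : Adj A E) : PreTensor E π →ₗ[ℂ] PreTensor E π :=
  LinearMap.rTensor F (a.1 : E →ₗ[ℂ] E)

lemma map_tmul (a : Adj A E) (x : E) (y : F) : map a (tmul π x y) = tmul π (a x) y := rfl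

lemma ip_map (a : Adj A E) (z w : PreTensor E π) : ⟪map a z, w⟫_B = ⟪z, map (star a) w⟫_B := by
  induction z using ind with
  | h0 => rw [map_zero, ip_zero_left, ip_zero_left]
  | h2 z z' h h' => rw [map_add, ip_add_left, h, h', ip_add_left]
  | h1 x y =>
    induction w using ind with
    | h0 => rw [map_zero, ip_zero_right, ip_zero_right]
    | h2 w w' h h' => rw [map_add, ip_add_right, h, h', ip_add_right]
    | h1 x' y' => rw [map_tmul, map_tmul, ip_tmul, ip_tmul, Adj.ip_star_right]

lemma map_mul (a b : Adj A E) (z : PreTensor E π) : map (a * b) z = map a (map b z) := by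
  induction z using ind with
  | h0 => simp only [map_zero]
  | h2 z z' h h' => simp only [map_add, h, h']
  | h1 x y => rfl

lemma map_add' (a b : Adj A E) (z : PreTensor E π) : map (a + b) z = map a z + map b z := by
  induction z using ind with
  | h0 => simp only [map_zero, add_zero]
  | h2 z z' h h' => simp only [map_add, h, h']; abel
  | h1 x y => exact TensorProduct.add_tmul _ _ _

lemma map_smul' (c : ℂ) (a : Adj A E) (z : PreTensor E π) : map (c • a) z = c • map a z := by
  induction z using ind with
  | h0 => simp only [map_zero, smul_zero]
  | h2 z z' h h' => simp only [map_add, h, h', smul_add]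
  | h1 x y => rfl

lemma map_one (z : PreTensor E π) : map (1 : Adj A E) z = z := by
  induction z using ind with
  | h0 => simp only [map_zero]
  | h2 z z' h h' => simp only [map_add, h, h']
  | h1 x y => rfl

lemma ip_map_self_le (a : Adj A E) (z : PreTensor E π) :
    ⟪map a z, map a z⟫_B ≤ ((‖a‖ ^ 2 : ℝ) : ℂ) • ⟪z, z⟫_B := by
  obtain ⟨c, hc⟩ := exists_eq_star_mul
    (sub_nonneg.2 (CStarAlgebra.star_mul_le_algebraMap_norm_sq (a := a)))
  have h1 : ((‖a‖ ^ 2 : ℝ) : ℂ) • (1 : Adj A E) = star c * c + star a * a := by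
    rw [← hc, sub_add_cancel, Algebra.algebraMap_eq_smul_one, Complex.coe_smul]
  have h2 : ((‖a‖ ^ 2 : ℝ) : ℂ) • ⟪z, z⟫_B = ⟪map c z, map c z⟫_B + ⟪map a z, map a z⟫_B := by
    rw [ip_map, ip_map, ← map_mul, ← map_mul, ← ip_add_right, ← map_add', ← h1, map_smul', map_one,
      ip_smul_right]
  rw [h2]
  exact le_add_of_nonneg_left (ip_self_nonneg _)

lemma norm_map_le (a : Adj A E) (z : PreTensor E π) :
    ‖HilbertCompletion.of B (map a z)‖ ≤ ‖a‖ * ‖HilbertCompletion.of B z‖ := by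
  refine abs_le_of_sq_le_sq' ?_ (by positivity) |>.2
  rw [mul_pow, HilbertCompletion.norm_of_sq, HilbertCompletion.norm_of_sq]
  refine (CStarAlgebra.norm_le_norm_of_nonneg_of_le (ip_self_nonneg _)
    (ip_map_self_le a z)).trans ?_
  rw [norm_smul, Complex.norm_real, Real.norm_of_nonneg (by positivity)]

end PreTensor

variable (E) in
/-- The internal tensor product `E ⊙_π F` of a Hilbert `A`-module `E` with a Hilbert `B`-module `F`
on which `A` acts from the left through the unital `⋆`-homomorphism `π : A → ℬᵃ(F)`: the completion
of `E ⊗ F` in the semi-inner product `⟪x ⊗ y, x' ⊗ y'⟫ = ⟪y, π(⟪x, x'⟫) y'⟫`. -/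
abbrev IntTensor : Type (max v w) := HilbertCompletion B (PreTensor E π)

/-- The elementary tensor `x ⊙ y`. -/
def tmul (x : E) (y : F) : IntTensor E π := HilbertCompletion.of B (PreTensor.tmul π x y)

lemma ip_tmul (x x' : E) (y y' : F) :
    ⟪tmul π x y, tmul π x' y'⟫_B = ⟪y, π ⟪x, x'⟫_A y'⟫_B := by
  rw [tmul, tmul, HilbertCompletion.ip_of, PreTensor.ip_tmul]

/-- `a ⊙ id_F` as a bounded operator. -/
def ampCLM (a : Adj A E) : IntTensor E π →L[ℂ] IntTensor E π :=
  HilbertCompletion.lift ((HilbertCompletion.of B).comp (PreTensor.map a))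

variable {π}

lemma ampCLM_of (a : Adj A E) (z : PreTensor E π) :
    ampCLM π a (HilbertCompletion.of B z) = HilbertCompletion.of B (PreTensor.map a z) :=
  HilbertCompletion.lift_of _ (PreTensor.norm_map_le a) z

lemma ampCLM_adj (a : Adj A E) (z w : IntTensor E π) :
    ⟪ampCLM π a z, w⟫_B = ⟪z, ampCLM π (star a) w⟫_B := by
  induction z using HilbertCompletion.ind with
  | hp => exact isClosed_eq (by fun_prop) (by fun_prop)
  | h z =>
  induction w using HilbertCompletion.ind with
  | hp => exact isClosed_eq (by fun_prop) (by fun_prop)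
  | h w =>
  rw [ampCLM_of, ampCLM_of, HilbertCompletion.ip_of, HilbertCompletion.ip_of, PreTensor.ip_map]

lemma IntTensor.ext_op {a b : Adj B (IntTensor E π)}
    (h : ∀ z, a (HilbertCompletion.of B z) = b (HilbertCompletion.of B z)) : a = b :=
  Subtype.ext (ContinuousLinearMap.ext fun z => by
    induction z using HilbertCompletion.ind with
    | hp => exact isClosed_eq a.1.continuous b.1.continuous
    | h z => exact h z)

variable (π)

/-- The canonical unital `⋆`-homomorphism `a ↦ a ⊙ id_F` from `ℬᵃ(E)` to `ℬᵃ(E ⊙ F)`. -/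
def amp : Adj A E →⋆ₐ[ℂ] Adj B (IntTensor E π) where
  toFun a := Adj.mk' (ampCLM π a) (ampCLM π (star a)) (ampCLM_adj a)
  map_one' := IntTensor.ext_op fun z => by
    simp only [Adj.mk'_apply, ampCLM_of, PreTensor.map_one, Adj.one_apply]
  map_mul' a b := IntTensor.ext_op fun z => by
    simp only [Adj.mk'_apply, ampCLM_of, PreTensor.map_mul, Adj.mul_apply]
  map_zero' := IntTensor.ext_op fun z => by
    have := PreTensor.map_smul' (0 : ℂ) (0 : Adj A E) z
    simp only [zero_smul] at this
    simp only [Adj.mk'_apply, ampCLM_of, this, map_zero, Adj.zero_apply]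
  map_add' a b := IntTensor.ext_op fun z => by
    simp only [Adj.mk'_apply, ampCLM_of, PreTensor.map_add', map_add, Adj.add_apply]
  commutes' c := IntTensor.ext_op fun z => by
    simp only [Algebra.algebraMap_eq_smul_one, Adj.mk'_apply, ampCLM_of, PreTensor.map_smul',
      PreTensor.map_one, map_smul, Adj.smul_apply, Adj.one_apply]
  map_star' a := Adj.eq_star fun z w => ampCLM_adj a z w

lemma amp_of (a : Adj A E) (z : PreTensor E π) :
    amp π a (HilbertCompletion.of B z) = HilbertCompletion.of B (PreTensor.map a z) := ampCLM_of a z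

lemma amp_tmul (a : Adj A E) (x : E) (y : F) : amp π a (tmul π x y) = tmul π (a x) y :=
  ampCLM_of a _

end Tensor

/-! ### The dual correspondence -/

section Dual

/-- The dual `E^*` of a Hilbert `B`-module `E`; its elements are the `x^*` with `x ∈ E`. -/
def DualModule (E : Type v) : Type v := E

variable {B : Type u} {E : Type v} [CStarAlgebra B] [PartialOrder B] [StarOrderedRing B]
  [NormedAddCommGroup E] [NormedSpace ℂ E] [CompleteSpace E] [Module Bᵐᵒᵖ E] [HilbertModule B E]

namespace DualModule

instance : NormedAddCommGroup (DualModule E) := inferInstanceAs (NormedAddCommGroup E)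
instance : CompleteSpace (DualModule E) := inferInstanceAs (CompleteSpace E)

/-- The vector `x^*`. -/
def dual (x : E) : DualModule E := x
/-- The vector `x` of a dual vector `x^*`. -/
def undual (x : DualModule E) : E := x

@[simp] lemma undual_dual (x : E) : undual (dual x) = x := rfl
@[simp] lemma dual_undual (x : DualModule E) : dual (undual x) = x := rfl
lemma undual_add (x y : DualModule E) : undual (x + y) = undual x + undual y := rfl
lemma norm_dual (x : E) : ‖dual x‖ = ‖x‖ := rfl

/-- `c x^* = (conj(c) x)^*`. -/
instance : NormedSpace ℂ (DualModule E) where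
  smul c x := dual (star c • undual x)
  one_smul x := by
    change dual (star (1 : ℂ) • undual x) = x
    rw [star_one, one_smul]; rfl
  mul_smul c d x := by
    change dual (star (c * d) • undual x) = dual (star c • (star d • undual x))
    rw [star_mul', mul_smul]
  smul_zero c := smul_zero (A := E) (star c)
  smul_add c x y := smul_add (A := E) (star c) x y
  add_smul c d x := by
    change dual (star (c + d) • undual x) = _
    rw [star_add, add_smul]; rfl
  zero_smul x := by
    change dual (star (0 : ℂ) • undual x) = 0
    rw [star_zero, zero_smul]; rfl
  norm_smul_le c x := by
    change ‖star c • undual x‖ ≤ ‖c‖ * ‖undual x‖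
    rw [norm_smul, norm_star]

lemma undual_smul (c : ℂ) (x : DualModule E) : undual (c • x) = star c • undual x := rfl

/-- `x^* a = (a^* x)^*` for `a ∈ ℬᵃ(E)`. -/
instance : Module (Adj B E)ᵐᵒᵖ (DualModule E) where
  smul a x := dual (star (unop a) (undual x))
  one_smul x := by
    change dual ((star (1 : Adj B E)) (undual x)) = x
    rw [star_one]; rfl
  mul_smul a b x := by
    change dual ((star (unop b * unop a)) (undual x)) = _
    rw [star_mul]; rfl
  smul_zero a := map_zero (star (unop a)).1
  smul_add a := map_add (star (unop a)).1
  add_smul a b x := by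
    change dual ((star (unop a + unop b)) (undual x)) = _
    rw [star_add]; rfl
  zero_smul x := by
    change dual ((star (0 : Adj B E)) (undual x)) = 0
    rw [star_zero]; rfl

lemma undual_op_smul (a : Adj B E) (x : DualModule E) : undual (op a • x) = star a (undual x) := rfl

/-- `⟪x^*, y^*⟫ = x y^*`. -/
instance : HilbertModule (Adj B E) (DualModule E) where
  inner x y := rankOne B (undual x) (undual y)
  ip_add_right x y z := rankOne_add_right (B := B) _ _ _
  ip_smul_right c x y := by rw [undual_smul, rankOne_smul_right, star_star]
  ip_op_smul_right a x y := by rw [undual_op_smul, rankOne_mul]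
  star_ip x y := star_rankOne _ _
  ip_self_nonneg x := rankOne_self_nonneg _
  norm_eq x := by rw [norm_rankOne_self, Real.sqrt_sq (norm_nonneg _)]; rfl

lemma ip_def (x y : DualModule E) : ⟪x, y⟫_(Adj B E) = rankOne B (undual x) (undual y) := rfl

/-- The bounded operator `x^* ↦ b x^* = (x b^*)^*`. -/
def leftCLM (b : B) : DualModule E →L[ℂ] DualModule E :=
  LinearMap.mkContinuous
    { toFun := fun x => dual (op (star b) • undual x)
      map_add' := fun x y => by rw [undual_add, smul_add]; rfl
      map_smul' := fun c x => by rw [undual_smul, smul_comm]; rfl }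
    ‖star b‖ fun x => norm_op_smul_le (star b) (undual x)

lemma leftCLM_apply (b : B) (x : DualModule E) :
    leftCLM b x = dual (op (star b) • undual x) := rfl

variable (B E) in
/-- The left action `b x^* = (x b^*)^*` of `B` on `E^*`. -/
def leftAction : B →⋆ₐ[ℂ] Adj (Adj B E) (DualModule E) where
  toFun b := Adj.mk' (leftCLM b) (leftCLM (star b)) fun x y => by
    change rankOne B (op (star b) • undual x) (undual y)
      = rankOne B (undual x) (op (star (star b)) • undual y)
    exact rankOne_op_smul _ _ _
  map_one' := Adj.ext' fun x => by
    simp only [Adj.mk'_apply, leftCLM_apply, star_one, op_one, one_smul]; rfl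
  map_mul' b c := Adj.ext' fun x => by
    simp only [Adj.mul_apply, Adj.mk'_apply, leftCLM_apply, star_mul, op_mul, mul_smul]; rfl
  map_zero' := Adj.ext' fun x => by
    simp only [Adj.mk'_apply, leftCLM_apply, star_zero, op_zero, zero_smul]; rfl
  map_add' b c := Adj.ext' fun x => by
    simp only [Adj.mk'_apply, leftCLM_apply, star_add, op_add, add_smul]; rfl
  commutes' c := Adj.ext' fun x => by
    simp only [Algebra.algebraMap_eq_smul_one, Adj.mk'_apply, leftCLM_apply, star_smul, star_one,
      op_smul_complex, op_one, one_smul]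
    rfl
  map_star' b := Adj.eq_star fun x y => by
    change rankOne B (op (star b) • undual x) (undual y)
      = rankOne B (undual x) (op (star (star b)) • undual y)
    exact rankOne_op_smul _ _ _

lemma leftAction_apply (b : B) (x : DualModule E) :
    leftAction B E b x = dual (op (star b) • undual x) := rfl

end DualModule

end Dual

/-! ### The correspondence of an endomorphism -/

open DualModule

section EndCorr

variable {B : Type u} {E : Type v} [CStarAlgebra B] [PartialOrder B] [StarOrderedRing B]
  [NormedAddCommGroup E] [NormedSpace ℂ E] [CompleteSpace E] [Module Bᵐᵒᵖ E] [HilbertModule B E]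

/-- The Hilbert `B`-module `E^* ⊙_φ E` of a unital endomorphism `φ` of `ℬᵃ(E)`. -/
abbrev EndCorr (φ : Adj B E →⋆ₐ[ℂ] Adj B E) : Type v := IntTensor (DualModule E) φ

/-- The left action of `B` on `E^* ⊙_φ E`, making it a correspondence over `B`. -/
def EndCorr.left (φ : Adj B E →⋆ₐ[ℂ] Adj B E) : B →⋆ₐ[ℂ] Adj B (EndCorr φ) :=
  (amp φ).comp (leftAction B E)

variable {φ ψ χ : Adj B E →⋆ₐ[ℂ] Adj B E}

/-- `y^* ⊗ z ↦ φ(x y^*) z` on the algebraic tensor product. -/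
def preAct (φ : Adj B E →⋆ₐ[ℂ] Adj B E) (x : E) : PreTensor (DualModule E) φ →ₗ[ℂ] E :=
  TensorProduct.lift (LinearMap.mk₂ ℂ (fun (y : DualModule E) (z : E) =>
      φ (rankOne B x (undual y)) z)
    (fun y₁ y₂ z => by rw [undual_add, rankOne_add_right, map_add, Adj.add_apply])
    (fun c y z => by rw [undual_smul, rankOne_smul_right, star_star, map_smul, Adj.smul_apply])
    (fun y z₁ z₂ => by rw [map_add])
    (fun c y z => by rw [map_smul]))

lemma preAct_tmul (x : E) (y : DualModule E) (z : E) :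
    preAct φ x (PreTensor.tmul φ y z) = φ (rankOne B x (undual y)) z := rfl

lemma ip_preAct (x x' : E) (m n : PreTensor (DualModule E) φ) :
    ⟪preAct φ x m, preAct φ x' n⟫_B = ⟪m, PreTensor.map (leftAction B E ⟪x, x'⟫_B) n⟫_B := by
  induction m using PreTensor.ind with
  | h0 => rw [map_zero, ip_zero_left, ip_zero_left]
  | h2 m m' h h' => rw [map_add, ip_add_left, h, h', ip_add_left]
  | h1 y z =>
    induction n using PreTensor.ind with
    | h0 => rw [map_zero, map_zero, ip_zero_right, ip_zero_right]
    | h2 n n' h h' => rw [map_add, ip_add_right, h, h', map_add, ip_add_right]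
    | h1 y' z' =>
      rw [preAct_tmul, preAct_tmul, PreTensor.map_tmul, leftAction_apply, PreTensor.ip_tmul,
        DualModule.ip_def, undual_dual, ← Adj.ip_star_right, ← map_star, star_rankOne, ← Adj.mul_apply, ← map_mul,
        mul_rankOne, rankOne_apply, rankOne_op_smul]

lemma norm_preAct_le (x : E) (m : PreTensor (DualModule E) φ) :
    ‖preAct φ x m‖ ≤ ‖x‖ * ‖HilbertCompletion.of B m‖ := by
  refine abs_le_of_sq_le_sq' ?_ (by positivity) |>.2
  rw [norm_sq_eq (B := B), ip_preAct, ← HilbertCompletion.ip_of m, ← amp_of]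
  have h1 : ‖leftAction B E ⟪x, x⟫_B‖ ≤ ‖x‖ ^ 2 := by
    rw [norm_sq_eq (B := B) x]
    exact NonUnitalStarAlgHom.norm_apply_le (leftAction B E) _
  have h2 : ‖amp φ (leftAction B E ⟪x, x⟫_B)‖ ≤ ‖x‖ ^ 2 :=
    (NonUnitalStarAlgHom.norm_apply_le (amp (E := DualModule E) φ) _).trans h1
  refine (HilbertModule.norm_ip_le _ _).trans ?_
  have h3 := Adj.norm_apply_le (amp φ (leftAction B E ⟪x, x⟫_B)) (HilbertCompletion.of B m)
  calc _ ≤ ‖HilbertCompletion.of B m‖ * (‖x‖ ^ 2 * ‖HilbertCompletion.of B m‖) := by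
        gcongr; exact h3.trans (by gcongr)
    _ = _ := by ring

/-- The bounded operator `m ↦ u_φ(x ⊙ m)`, where `u_φ : E ⊙ (E^* ⊙_φ E) → E` is determined by
`u_φ(x ⊙ (y^* ⊙ z)) = φ(x y^*) z`. -/
def EndCorr.act (φ : Adj B E →⋆ₐ[ℂ] Adj B E) (x : E) : EndCorr φ →L[ℂ] E :=
  HilbertCompletion.lift (preAct φ x)

lemma EndCorr.act_of (x : E) (m : PreTensor (DualModule E) φ) :
    act φ x (HilbertCompletion.of B m) = preAct φ x m :=
  HilbertCompletion.lift_of _ (norm_preAct_le x) m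

lemma EndCorr.act_tmul (x y z : E) : act φ x (tmul φ (dual y) z) = φ (rankOne B x y) z :=
  act_of _ _

lemma EndCorr.act_add (x x' : E) (m : EndCorr φ) : act φ (x + x') m = act φ x m + act φ x' m := by
  induction m using HilbertCompletion.ind with
  | hp => exact isClosed_eq (by fun_prop) (by fun_prop)
  | h m =>
    simp only [act_of]
    induction m using PreTensor.ind with
    | h0 => simp only [map_zero, add_zero]
    | h2 m m' h h' => simp only [map_add, h, h']; abel
    | h1 y z =>
      change φ (rankOne B (x + x') (undual y)) z = _
      rw [rankOne_add_left, map_add]; rfl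

lemma EndCorr.act_smul (c : ℂ) (x : E) (m : EndCorr φ) : act φ (c • x) m = c • act φ x m := by
  induction m using HilbertCompletion.ind with
  | hp => exact isClosed_eq (by fun_prop) (by fun_prop)
  | h m =>
    simp only [act_of]
    induction m using PreTensor.ind with
    | h0 => simp only [map_zero, smul_zero]
    | h2 m m' h h' => simp only [map_add, h, h', smul_add]
    | h1 y z =>
      change φ (rankOne B (c • x) (undual y)) z = _
      rw [rankOne_smul_left, map_smul]; rfl

lemma EndCorr.act_apply (a : Adj B E) (x : E) (m : EndCorr φ) :
    act φ (a x) m = φ a (act φ x m) := by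
  induction m using HilbertCompletion.ind with
  | hp => exact isClosed_eq (by fun_prop) ((φ a).1.continuous.comp (act φ x).continuous)
  | h m =>
    simp only [act_of]
    induction m using PreTensor.ind with
    | h0 => simp only [map_zero]
    | h2 m m' h h' => simp only [map_add, h, h']
    | h1 y z =>
      change φ (rankOne B (a x) (undual y)) z = φ a (φ (rankOne B x (undual y)) z)
      rw [← mul_rankOne, map_mul]; rfl

lemma EndCorr.ip_act (x x' : E) (m n : EndCorr φ) :
    ⟪act φ x m, act φ x' n⟫_B = ⟪m, left φ ⟪x, x'⟫_B n⟫_B := by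
  induction m using HilbertCompletion.ind with
  | hp => exact isClosed_eq (by fun_prop) (by fun_prop)
  | h m =>
  induction n using HilbertCompletion.ind with
  | hp =>
    exact isClosed_eq (by fun_prop)
      (HilbertModule.continuous_ip continuous_const (left φ ⟪x, x'⟫_B).1.continuous)
  | h n =>
    rw [act_of, act_of, ip_preAct, ← HilbertCompletion.ip_of m, ← amp_of]; rfl

/-- `x^* ⊗ x' ↦ x^* ⊙ u_ψ(x' ⊙ n)`. -/
def preMul (φ ψ χ : Adj B E →⋆ₐ[ℂ] Adj B E) (n : EndCorr ψ) :
    PreTensor (DualModule E) φ →ₗ[ℂ] EndCorr χ :=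
  TensorProduct.lift (LinearMap.mk₂ ℂ (fun (x : DualModule E) (x' : E) =>
      tmul χ x (EndCorr.act ψ x' n))
    (fun x₁ x₂ x' => by
      rw [tmul, tmul, tmul, ← map_add]; exact congrArg _ (TensorProduct.add_tmul _ _ _))
    (fun c x x' => by rw [tmul, tmul, ← map_smul]; rfl)
    (fun x x₁ x₂ => by
      rw [tmul, tmul, tmul, ← map_add, EndCorr.act_add]
      exact congrArg _ (TensorProduct.tmul_add _ _ _))
    (fun c x x' => by
      rw [tmul, tmul, ← map_smul, EndCorr.act_smul]
      exact congrArg _ (TensorProduct.tmul_smul _ _ _)))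

lemma preMul_tmul (n : EndCorr ψ) (x : DualModule E) (x' : E) :
    preMul φ ψ χ n (PreTensor.tmul φ x x') = tmul χ x (EndCorr.act ψ x' n) := rfl

lemma ip_preMul (h : ∀ a, χ a = ψ (φ a)) (n n' : EndCorr ψ) (m m' : PreTensor (DualModule E) φ) :
    ⟪preMul φ ψ χ n m, preMul φ ψ χ n' m'⟫_B = ⟪n, EndCorr.left ψ ⟪m, m'⟫_B n'⟫_B := by
  induction m using PreTensor.ind with
  | h0 => rw [map_zero, ip_zero_left, ip_zero_left, map_zero, Adj.zero_apply, ip_zero_right]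
  | h2 m₁ m₂ h₁ h₂ =>
    rw [map_add, ip_add_left, h₁, h₂, ip_add_left, map_add, Adj.add_apply, ip_add_right]
  | h1 x x' =>
    induction m' using PreTensor.ind with
    | h0 => rw [map_zero, ip_zero_right, ip_zero_right, map_zero, Adj.zero_apply, ip_zero_right]
    | h2 m₁ m₂ h₁ h₂ =>
      rw [map_add, ip_add_right, h₁, h₂, ip_add_right, map_add, Adj.add_apply, ip_add_right]
    | h1 y y' =>
      rw [preMul_tmul, preMul_tmul, ip_tmul, PreTensor.ip_tmul, h, ← EndCorr.act_apply,
        EndCorr.ip_act]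

lemma norm_preMul_le (h : ∀ a, χ a = ψ (φ a)) (n : EndCorr ψ) (m : PreTensor (DualModule E) φ) :
    ‖preMul φ ψ χ n m‖ ≤ ‖n‖ * ‖HilbertCompletion.of B m‖ := by
  refine abs_le_of_sq_le_sq' ?_ (by positivity) |>.2
  rw [norm_sq_eq (B := B), ip_preMul h, mul_pow, HilbertCompletion.norm_of_sq]
  have h2 : ‖EndCorr.left ψ ⟪m, m⟫_B‖ ≤ ‖⟪m, m⟫_B‖ :=
    NonUnitalStarAlgHom.norm_apply_le (EndCorr.left ψ) _
  refine (HilbertModule.norm_ip_le _ _).trans ?_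
  have h3 := Adj.norm_apply_le (EndCorr.left ψ ⟪m, m⟫_B) n
  calc _ ≤ ‖n‖ * (‖⟪m, m⟫_B‖ * ‖n‖) := by
        gcongr; exact h3.trans (by gcongr)
    _ = _ := by ring

/-- The product `(m, n) ↦ u(m ⊙ n)` of the correspondences of `φ` and `ψ`, with values in that of
`χ = ψ ∘ φ`; it is determined by `u((x^* ⊙ x') ⊙ n) = x^* ⊙ u_ψ(x' ⊙ n)`, that is, by
`u((x^* ⊙ x') ⊙ (y^* ⊙ y')) = x^* ⊙ ψ(x' y^*) y'`. -/
def EndCorr.mul (φ ψ χ : Adj B E →⋆ₐ[ℂ] Adj B E) (m : EndCorr φ) (n : EndCorr ψ) : EndCorr χ :=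
  HilbertCompletion.lift (preMul φ ψ χ n) m

lemma EndCorr.mul_tmul (h : ∀ a, χ a = ψ (φ a)) (x x' y y' : E) :
    mul φ ψ χ (tmul φ (dual x) x') (tmul ψ (dual y) y')
      = tmul χ (dual x) (ψ (rankOne B x' y) y') := by
  have h1 := HilbertCompletion.lift_of _ (norm_preMul_le h (tmul ψ (dual y) y'))
    (PreTensor.tmul φ (dual x) x')
  rw [preMul_tmul, act_tmul] at h1
  exact h1

end EndCorr

/-! ### Semigroups and dilations -/

section Semigroup

/-- An `E₀`-semigroup on `ℬᵃ(E)`: a semigroup of unital `⋆`-endomorphisms. -/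
structure E0Semigroup (𝕋 : Type w) [AddCommMonoid 𝕋] (B : Type u) (E : Type v) [CStarAlgebra B]
    [PartialOrder B] [NormedAddCommGroup E] [NormedSpace ℂ E] [CompleteSpace E] [Module Bᵐᵒᵖ E]
    [HilbertModule B E] where
  toFun : 𝕋 → Adj B E →⋆ₐ[ℂ] Adj B E
  map_zero : ∀ a, toFun 0 a = a
  map_add : ∀ s t a, toFun (s + t) a = toFun s (toFun t a)

instance (𝕋 : Type w) [AddCommMonoid 𝕋] (B : Type u) (E : Type v) [CStarAlgebra B]
    [PartialOrder B] [NormedAddCommGroup E] [NormedSpace ℂ E] [CompleteSpace E] [Module Bᵐᵒᵖ E]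
    [HilbertModule B E] :
    CoeFun (E0Semigroup 𝕋 B E) fun _ => 𝕋 → Adj B E →⋆ₐ[ℂ] Adj B E := ⟨E0Semigroup.toFun⟩

/-- A unital CP-semigroup on `B`. -/
structure UnitalCPSemigroup (𝕋 : Type w) [AddCommMonoid 𝕋] (B : Type u) [CStarAlgebra B]
    [PartialOrder B] [StarOrderedRing B] where
  toFun : 𝕋 → B →CP B
  map_zero : ∀ b, toFun 0 b = b
  map_add : ∀ s t b, toFun (s + t) b = toFun s (toFun t b)
  map_one : ∀ t, toFun t 1 = 1

instance (𝕋 : Type w) [AddCommMonoid 𝕋] (B : Type u) [CStarAlgebra B] [PartialOrder B]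
    [StarOrderedRing B] : CoeFun (UnitalCPSemigroup 𝕋 B) fun _ => 𝕋 → B →CP B :=
  ⟨UnitalCPSemigroup.toFun⟩

variable {𝕋 : Type w} [AddCommMonoid 𝕋] {B : Type u} {E : Type v}
  [CStarAlgebra B] [PartialOrder B] [StarOrderedRing B]
  [NormedAddCommGroup E] [NormedSpace ℂ E] [CompleteSpace E] [Module Bᵐᵒᵖ E] [HilbertModule B E]

namespace E0Semigroup

/-- All endomorphisms of the semigroup are strict. -/
def IsStrict (ϑ : E0Semigroup 𝕋 B E) : Prop := ∀ t, IsStrictEnd (ϑ t)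

/-- The member `E_t = E^* ⊙_{ϑ_t} E` of the product system of `ϑ`, for `t ≠ 0`. (The member at
`0` is `B`, and needs no name of its own; see `CentralUnitalUnit`.) -/
abbrev Fiber (ϑ : E0Semigroup 𝕋 B E) (t : 𝕋) : Type v := EndCorr (ϑ t)

/-- The product `(m, n) ↦ u_{st}(m ⊙ n)` of the product system of `ϑ`, determined by
`u_{st}((x^* ⊙ x') ⊙ (y^* ⊙ y')) = x^* ⊙ ϑ_t(x' y^*) y'`. -/
def fiberMul (ϑ : E0Semigroup 𝕋 B E) {s t : 𝕋} (m : ϑ.Fiber s) (n : ϑ.Fiber t) :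
    ϑ.Fiber (s + t) :=
  EndCorr.mul (ϑ s) (ϑ t) (ϑ (s + t)) m n

lemma fiberMul_tmul (ϑ : E0Semigroup 𝕋 B E) {s t : 𝕋} (x x' y y' : E) :
    ϑ.fiberMul (tmul (ϑ s) (dual x) x') (tmul (ϑ t) (dual y) y')
      = tmul (ϑ (s + t)) (dual x) (ϑ t (rankOne B x' y) y') :=
  EndCorr.mul_tmul (fun a => by rw [add_comm, ϑ.map_add]) x x' y y'

/-- A central unital unit `ω` of the product system of `ϑ`. As the member at time `0` is `B` with
`ω_0 = 1`, and as the product with an element of `B` is the module action, the conditions that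
involve the time `0` hold trivially; only those at nonzero times are listed. -/
structure CentralUnitalUnit (ϑ : E0Semigroup 𝕋 B E) where
  vec : ∀ t, ϑ.Fiber t
  mul : ∀ s t, s ≠ 0 → t ≠ 0 → ϑ.fiberMul (vec s) (vec t) = vec (s + t)
  unital : ∀ t, t ≠ 0 → ⟪vec t, vec t⟫_B = 1
  central : ∀ t, t ≠ 0 → ∀ b : B, EndCorr.left (ϑ t) b (vec t) = op b • vec t

/-- `ϑ` is spatial if its product system admits a central unital unit. -/
def IsSpatial (ϑ : E0Semigroup 𝕋 B E) : Prop := Nonempty ϑ.CentralUnitalUnit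

/-- `(E, ϑ, ξ)` is a weak dilation of `T`: `ξ` is a unit vector, the projection `ξ ξ^*` is
increasing for `ϑ`, and `T_t(b) = ⟪ξ, ϑ_t(ξ b ξ^*) ξ⟫`. -/
structure IsWeakDilation (ϑ : E0Semigroup 𝕋 B E) (ξ : E) (T : UnitalCPSemigroup 𝕋 B) : Prop where
  unit : ⟪ξ, ξ⟫_B = 1
  increasing : ∀ t, rankOne B ξ ξ ≤ ϑ t (rankOne B ξ ξ)
  eq : ∀ t b, T t b = ⟪ξ, ϑ t (vecEmbedding ξ unit b) ξ⟫_B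

/-- `α` is a dilation of `T` with respect to the embedding `i` in the vector expectation
`⟪v, • v⟫`. -/
structure IsDilation (α : E0Semigroup 𝕋 B E) (i : B →⋆ₙₐ[ℂ] Adj B E) (v : E)
    (T : UnitalCPSemigroup 𝕋 B) : Prop where
  injective : Function.Injective i
  unit : ⟪v, v⟫_B = 1
  eq : ∀ t b, ⟪v, α t (i b) v⟫_B = T t b

/-- The automorphism semigroup `α_t = w_t • w_t^*` of a semigroup of unitaries. -/
def ofUnitary (w : Multiplicative 𝕋 →* unitary (Adj B E)) : E0Semigroup 𝕋 B E where
  toFun t := (Unitary.conjStarAlgAut ℂ (Adj B E) (w (.ofAdd t))).toStarAlgHom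
  map_zero a := by
    change Unitary.conjStarAlgAut ℂ (Adj B E) (w 1) a = a
    rw [w.map_one, MonoidHom.map_one]; rfl
  map_add s t a := by
    change Unitary.conjStarAlgAut ℂ (Adj B E) (w (.ofAdd s * .ofAdd t)) a = _
    rw [w.map_mul, MonoidHom.map_mul]; rfl

lemma ofUnitary_apply (w : Multiplicative 𝕋 →* unitary (Adj B E)) (t : 𝕋) (a : Adj B E) :
    ofUnitary w t a = (w (.ofAdd t) : Adj B E) * a * star (w (.ofAdd t) : Adj B E) := rfl

end E0Semigroup

end Semigroup

end HilbMod

end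

open HilbMod

noncomputable section

namespace HilbMod

open SemiHilbert HilbertModule DualModule

/-! ### Maps that preserve inner products -/

section Isometry

variable {B : Type u} {V : Type*} {E F : Type*} [CStarAlgebra B] [PartialOrder B]
  [StarOrderedRing B] [AddCommGroup V] [Module ℂ V] [Module Bᵐᵒᵖ V] [SemiHilbert B V]
  [NormedAddCommGroup E] [NormedSpace ℂ E] [CompleteSpace E] [Module Bᵐᵒᵖ E] [HilbertModule B E]
  [NormedAddCommGroup F] [NormedSpace ℂ F] [CompleteSpace F] [Module Bᵐᵒᵖ F] [HilbertModule B F]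

/-! A central unital unit turns the endomorphisms $\vartheta_t$ into something implemented by
isometries. Put $V_tx=u_t(x\odot\omega_t)$ on $E$, with $u_t(x\odot(y^*\odot
z))=\vartheta_t(xy^*)z$. Since $\omega_t$ is a central unit vector, $V_t$ preserves inner products.
Associativity of the product makes $V$ a semigroup, and $u_t(ax\odot m)=\vartheta_t(a)u_t(x\odot m)$
gives $V_ta=\vartheta_t(a)V_t$ (`EndCorr.act_mul`, `EndCorr.ip_act`, `EndCorr.act_apply`).

Isometries become unitary in an inductive limit. Let $H$ be the limit of copies of $E$, indexed by
$\mathbb T$, along the maps $V_r$. Letting $a$ act as $\vartheta_t(a)$ on the copy with index $t$ is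
compatible with the connecting maps and gives a representation `rep` of $\mathcal B^a(E)$ on $H$.
The $V_t$ extend to unitaries $W_t$ of $H$, because $W_t$ sends the copy $s+t$ identically onto the
copy $s$. They satisfy $W_t\,\mathrm{rep}(a)=\mathrm{rep}(\vartheta_t(a))W_t$ (`shiftIso_rep`).

It remains to write $H$ as a tensor product with $E$. Strictness makes the rank-one operators act
nondegenerately on $H$ (`isNondegenerate_rep`), and then $x\odot(y^*\odot
h)\mapsto\mathrm{rep}(xy^*)h$ is a unitary $u:E\odot(E^*\odot H)\to H$ that carries
$a\odot\mathrm{id}$ to $\mathrm{rep}(a)$ (`evalIso`, `evalIso_amp`). So $E_-=E^*\odot H$ and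
$w_t=u^*W_tu$ satisfy condition 2.

For $\omega_-$ take $\xi_+^*\odot\xi_+$, with the second factor in the copy with index $0$, where
`rep` is the identity representation. Because $x\xi_+^*\xi_+=x$, the unitary $u$ maps
$x\odot\omega_-$ to $x$ in that copy. For any central unit vector $\omega_-$ the map $x\mapsto
x\odot\omega_-$ is isometric, which gives the injectivity of $a\mapsto a\odot\mathrm{id}$ and
reduces the dilation formula to the given weak dilation. -/

lemma norm_eq_of_ip {f : V → F} (h : ∀ x y, ⟪f x, f y⟫_B = ⟪x, y⟫_B) (x : V) :
    ‖f x‖ = ‖HilbertCompletion.of B x‖ := by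
  rw [norm_eq (B := B), h, HilbertCompletion.norm_of]

/-- Expanding the square of $f(xb)-f(x)b$ leaves only inner products of images, which equal those of
$xb-xb=0$. Right $\mathcal B$-linearity is thus automatic. -/
lemma map_op_smul_of_ip {f : E →ₗ[ℂ] F} (h : ∀ x y, ⟪f x, f y⟫_B = ⟪x, y⟫_B) (b : B) (x : E) :
    f (op b • x) = op b • f x := by
  refine sub_eq_zero.1 (eq_zero_of_ip_self (B := B) ?_)
  simp only [ip_sub_left, ip_sub_right, ip_op_smul_left, ip_op_smul_right, h]
  simp [mul_assoc]

/-- The extension of an inner product preserving map with dense range to a unitary from the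
completion. -/
def completionIso (f : V →ₗ[ℂ] F) (h : ∀ x y, ⟪f x, f y⟫_B = ⟪x, y⟫_B)
    (hd : (Submodule.span ℂ (Set.range f)).topologicalClosure = ⊤) :
    HilbertCompletion B V ≃ₗᵢ[ℂ] F :=
  let g : HilbertCompletion B V →ₗᵢ[ℂ] F :=
    { toLinearMap := (HilbertCompletion.lift f).toLinearMap
      norm_map' := fun x => by
        induction x using HilbertCompletion.ind with
        | hp => exact isClosed_eq (HilbertCompletion.lift f).continuous.norm continuous_norm
        | h x =>
          rw [← norm_eq_of_ip h x]
          exact congrArg norm (HilbertCompletion.lift_of f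
            (fun x => (norm_eq_of_ip h x).le.trans (one_mul _).ge) x) }
  LinearIsometryEquiv.ofSurjective g (by
    -- The range of an isometry on a complete space is closed, so it is enough that it contains a
    -- total set.
    have hc : IsClosed (Set.range g) := g.isometry.isClosedEmbedding.isClosed_range
    have hle : (Submodule.span ℂ (Set.range f)).topologicalClosure ≤ LinearMap.range g.toLinearMap := by
      refine Submodule.topologicalClosure_minimal _ (Submodule.span_le.2 ?_) ?_
      · rintro _ ⟨x, rfl⟩
        exact ⟨HilbertCompletion.of B x, HilbertCompletion.lift_of f
          (fun x => (norm_eq_of_ip h x).le.trans (one_mul _).ge) x⟩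
      · exact hc
    intro y
    exact hle (hd ▸ Submodule.mem_top))

lemma completionIso_of (f : V →ₗ[ℂ] F) (h : ∀ x y, ⟪f x, f y⟫_B = ⟪x, y⟫_B)
    (hd : (Submodule.span ℂ (Set.range f)).topologicalClosure = ⊤) (x : V) :
    completionIso f h hd (HilbertCompletion.of B x) = f x :=
  HilbertCompletion.lift_of f (fun x => (norm_eq_of_ip h x).le.trans (one_mul _).ge) x

lemma ip_completionIso (f : V →ₗ[ℂ] F) (h : ∀ x y, ⟪f x, f y⟫_B = ⟪x, y⟫_B)
    (hd : (Submodule.span ℂ (Set.range f)).topologicalClosure = ⊤) (x y : HilbertCompletion B V) :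
    ⟪completionIso f h hd x, completionIso f h hd y⟫_B = ⟪x, y⟫_B := by
  induction x using HilbertCompletion.ind with
  | hp => exact isClosed_eq (by fun_prop) (by fun_prop)
  | h x =>
  induction y using HilbertCompletion.ind with
  | hp => exact isClosed_eq (by fun_prop) (by fun_prop)
  | h y => rw [completionIso_of, completionIso_of, h, HilbertCompletion.ip_of]

/-- An inner product preserving automorphism as a unitary of `ℬᵃ(E)`. -/
def unitaryOfIso (e : E ≃ₗᵢ[ℂ] E) (h : ∀ x y, ⟪e x, e y⟫_B = ⟪x, y⟫_B) : unitary (Adj B E) :=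
  let a : Adj B E := Adj.mk' (e : E →L[ℂ] E) (e.symm : E →L[ℂ] E) fun x y => by
    change ⟪e x, y⟫_B = ⟪x, e.symm y⟫_B
    rw [← h x, e.apply_symm_apply]
  let b : Adj B E := Adj.mk' (e.symm : E →L[ℂ] E) (e : E →L[ℂ] E) fun x y => by
    change ⟪e.symm x, y⟫_B = ⟪x, e y⟫_B
    rw [← h _ y, e.apply_symm_apply]
  have hs : star a = b := (Adj.eq_star fun x y => by
    change ⟪e x, y⟫_B = ⟪x, e.symm y⟫_B
    rw [← h x, e.apply_symm_apply]).symm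
  ⟨a, Unitary.mem_iff.2 ⟨by rw [hs]; exact Adj.ext' e.symm_apply_apply,
    by rw [hs]; exact Adj.ext' e.apply_symm_apply⟩⟩

/-- A semigroup of inner product preserving automorphisms as a semigroup of unitaries. -/
def unitarySemigroup {𝕋 : Type*} [AddCommMonoid 𝕋] (e : 𝕋 → E ≃ₗᵢ[ℂ] E)
    (h : ∀ t x y, ⟪e t x, e t y⟫_B = ⟪x, y⟫_B) (h₀ : ∀ x, e 0 x = x)
    (h₁ : ∀ s t x, e (s + t) x = e s (e t x)) : Multiplicative 𝕋 →* unitary (Adj B E) where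
  toFun t := unitaryOfIso (e t.toAdd) (h t.toAdd)
  map_one' := Subtype.ext (Adj.ext' h₀)
  map_mul' s t := Subtype.ext (Adj.ext' (h₁ s.toAdd t.toAdd))

/-- An intertwining relation $w_ta=bw_t$ with $w_t$ unitary is the same as $w_taw_t^*=b$. This is
how relations between operators enter the automorphism semigroup. -/
lemma ofUnitary_unitarySemigroup {𝕋 : Type*} [AddCommMonoid 𝕋] (e : 𝕋 → E ≃ₗᵢ[ℂ] E)
    (h : ∀ t x y, ⟪e t x, e t y⟫_B = ⟪x, y⟫_B) (h₀ : ∀ x, e 0 x = x)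
    (h₁ : ∀ s t x, e (s + t) x = e s (e t x)) {t : 𝕋} {a b : Adj B E}
    (hab : ∀ x, e t (a x) = b (e t x)) :
    E0Semigroup.ofUnitary (unitarySemigroup e h h₀ h₁) t a = b := by
  have hw : (unitarySemigroup e h h₀ h₁ (.ofAdd t) : Adj B E) * a
      = b * (unitarySemigroup e h h₀ h₁ (.ofAdd t) : Adj B E) := Adj.ext' hab
  rw [E0Semigroup.ofUnitary_apply, hw, mul_assoc, Unitary.mul_star_self_of_mem (Subtype.prop _),
    mul_one]

end Isometry

/-! ### The unitary `E ⊙ (E^* ⊙_π H) → H` -/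

section DualTensor

variable {B : Type u} {E : Type v} {H : Type w} [CStarAlgebra B] [PartialOrder B] [StarOrderedRing B]
  [NormedAddCommGroup E] [NormedSpace ℂ E] [CompleteSpace E] [Module Bᵐᵒᵖ E] [HilbertModule B E]
  [NormedAddCommGroup H] [NormedSpace ℂ H] [CompleteSpace H] [Module Bᵐᵒᵖ H] [HilbertModule B H]

/-- The left action of `B` on `E^* ⊙_π H`. -/
def dualLeft (π : Adj B E →⋆ₐ[ℂ] Adj B H) : B →⋆ₐ[ℂ] Adj B (IntTensor (DualModule E) π) :=
  (amp π).comp (leftAction B E)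

variable {π : Adj B E →⋆ₐ[ℂ] Adj B H}

lemma dualLeft_tmul (b : B) (x : E) (h : H) :
    dualLeft π b (tmul π (dual x) h) = tmul π (dual (op (star b) • x)) h := amp_tmul π _ _ _

/-- `y^* ⊗ h ↦ π(x y^*) h` on the algebraic tensor product. -/
def preDualAct (π : Adj B E →⋆ₐ[ℂ] Adj B H) (x : E) : PreTensor (DualModule E) π →ₗ[ℂ] H :=
  TensorProduct.lift (LinearMap.mk₂ ℂ (fun (y : DualModule E) (z : H) =>
      π (rankOne B x (undual y)) z)
    (fun y₁ y₂ z => by rw [undual_add, rankOne_add_right, map_add, Adj.add_apply])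
    (fun c y z => by rw [undual_smul, rankOne_smul_right, star_star, map_smul, Adj.smul_apply])
    (fun y z₁ z₂ => by rw [map_add])
    (fun c y z => by rw [map_smul]))

lemma preDualAct_tmul (x : E) (y : DualModule E) (z : H) :
    preDualAct π x (PreTensor.tmul π y z) = π (rankOne B x (undual y)) z := rfl

/-- On elementary tensors both sides are $\langle z,\pi(y\langle x,x'\rangle y'^*)z'\rangle$,
because $(xy^*)^*(x'y'^*)=y\langle x,x'\rangle y'^*$. This is the isometry of $u$ on
$E\odot(E^*\odot_\pi H)$, written out one left factor at a time. -/
lemma ip_preDualAct (x x' : E) (m n : PreTensor (DualModule E) π) :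
    ⟪preDualAct π x m, preDualAct π x' n⟫_B
      = ⟪m, PreTensor.map (leftAction B E ⟪x, x'⟫_B) n⟫_B := by
  induction m using PreTensor.ind with
  | h0 => rw [map_zero, ip_zero_left, ip_zero_left]
  | h2 m m' h h' => rw [map_add, ip_add_left, h, h', ip_add_left]
  | h1 y z =>
    induction n using PreTensor.ind with
    | h0 => rw [map_zero, map_zero, ip_zero_right, ip_zero_right]
    | h2 n n' h h' => rw [map_add, ip_add_right, h, h', map_add, ip_add_right]
    | h1 y' z' =>
      rw [preDualAct_tmul, preDualAct_tmul, PreTensor.map_tmul, leftAction_apply,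
        PreTensor.ip_tmul, DualModule.ip_def, undual_dual, ← Adj.ip_star_right, ← map_star,
        star_rankOne, ← Adj.mul_apply, ← map_mul, mul_rankOne, rankOne_apply, rankOne_op_smul]

/-- The squared norm is that of $\langle m,\langle x,x\rangle m\rangle$, and $*$-homomorphisms of
$C^*$-algebras are contractive. The bound allows the extension to the completion. -/
lemma norm_preDualAct_le (x : E) (m : PreTensor (DualModule E) π) :
    ‖preDualAct π x m‖ ≤ ‖x‖ * ‖HilbertCompletion.of B m‖ := by
  refine abs_le_of_sq_le_sq' ?_ (by positivity) |>.2
  rw [norm_sq_eq (B := B), ip_preDualAct, ← HilbertCompletion.ip_of m, ← amp_of]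
  have h1 : ‖leftAction B E ⟪x, x⟫_B‖ ≤ ‖x‖ ^ 2 := by
    rw [norm_sq_eq (B := B) x]
    exact NonUnitalStarAlgHom.norm_apply_le (leftAction B E) _
  have h2 : ‖amp π (leftAction B E ⟪x, x⟫_B)‖ ≤ ‖x‖ ^ 2 :=
    (NonUnitalStarAlgHom.norm_apply_le (amp (E := DualModule E) π) _).trans h1
  refine (HilbertModule.norm_ip_le _ _).trans ?_
  have h3 := Adj.norm_apply_le (amp π (leftAction B E ⟪x, x⟫_B)) (HilbertCompletion.of B m)
  calc _ ≤ ‖HilbertCompletion.of B m‖ * (‖x‖ ^ 2 * ‖HilbertCompletion.of B m‖) := by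
        gcongr; exact h3.trans (by gcongr)
    _ = _ := by ring

/-- The bounded operator `y^* ⊙ h ↦ π(x y^*) h`. -/
def dualAct (π : Adj B E →⋆ₐ[ℂ] Adj B H) (x : E) : IntTensor (DualModule E) π →L[ℂ] H :=
  HilbertCompletion.lift (preDualAct π x)

lemma dualAct_of (x : E) (m : PreTensor (DualModule E) π) :
    dualAct π x (HilbertCompletion.of B m) = preDualAct π x m :=
  HilbertCompletion.lift_of _ (norm_preDualAct_le x) m

lemma dualAct_tmul (x y : E) (z : H) :
    dualAct π x (tmul π (dual y) z) = π (rankOne B x y) z := dualAct_of _ _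

lemma dualAct_ext {f g : IntTensor (DualModule E) π →L[ℂ] H}
    (h : ∀ (y : E) (z : H), f (tmul π (dual y) z) = g (tmul π (dual y) z))
    (m : IntTensor (DualModule E) π) : f m = g m := by
  induction m using HilbertCompletion.ind with
  | hp => exact isClosed_eq f.continuous g.continuous
  | h m =>
    induction m using PreTensor.ind with
    | h0 => simp only [map_zero]
    | h2 m m' h h' => simp only [map_add, h, h']
    | h1 y z => exact h (undual y) z

lemma dualAct_add (x x' : E) (m : IntTensor (DualModule E) π) :
    dualAct π (x + x') m = dualAct π x m + dualAct π x' m :=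
  dualAct_ext (g := dualAct π x + dualAct π x') (fun y z => by
    rw [_root_.add_apply, dualAct_tmul, dualAct_tmul, dualAct_tmul, rankOne_add_left,
      map_add, Adj.add_apply]) m

lemma dualAct_smul (c : ℂ) (x : E) (m : IntTensor (DualModule E) π) :
    dualAct π (c • x) m = c • dualAct π x m :=
  dualAct_ext (g := c • dualAct π x) (fun y z => by
    rw [_root_.smul_apply, dualAct_tmul, dualAct_tmul, rankOne_smul_left,
      map_smul, Adj.smul_apply]) m

/-- From $a(xy^*)=(ax)y^*$. It is the reason why $u$ carries $a\odot\mathrm{id}$ to $\pi(a)$. -/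
lemma dualAct_apply (a : Adj B E) (x : E) (m : IntTensor (DualModule E) π) :
    dualAct π (a x) m = π a (dualAct π x m) :=
  dualAct_ext (g := (π a).1 ∘L dualAct π x) (fun y z => by
    rw [ContinuousLinearMap.comp_apply, dualAct_tmul, dualAct_tmul, ← mul_rankOne, map_mul]
    rfl) m

lemma ip_dualAct (x x' : E) (m n : IntTensor (DualModule E) π) :
    ⟪dualAct π x m, dualAct π x' n⟫_B = ⟪m, dualLeft π ⟪x, x'⟫_B n⟫_B := by
  induction m using HilbertCompletion.ind with
  | hp => exact isClosed_eq (by fun_prop) (by fun_prop)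
  | h m =>
  induction n using HilbertCompletion.ind with
  | hp =>
    exact isClosed_eq (by fun_prop)
      (HilbertModule.continuous_ip continuous_const (dualLeft π ⟪x, x'⟫_B).1.continuous)
  | h n =>
    rw [dualAct_of, dualAct_of, ip_preDualAct, ← HilbertCompletion.ip_of m, ← amp_of]; rfl

/-- `x ⊗ m ↦ u(x ⊙ m)` on the algebraic tensor product. -/
def preEval (π : Adj B E →⋆ₐ[ℂ] Adj B H) : PreTensor E (dualLeft π) →ₗ[ℂ] H :=
  TensorProduct.lift (LinearMap.mk₂ ℂ (fun x m => dualAct π x m) dualAct_add dualAct_smul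
    (fun _ => map_add _) (fun c _ => map_smul _ c))

lemma preEval_tmul (x : E) (m : IntTensor (DualModule E) π) :
    preEval π (PreTensor.tmul (dualLeft π) x m) = dualAct π x m := rfl

lemma ip_preEval (z z' : PreTensor E (dualLeft π)) :
    ⟪preEval π z, preEval π z'⟫_B = ⟪z, z'⟫_B := by
  induction z using PreTensor.ind with
  | h0 => rw [map_zero, ip_zero_left, ip_zero_left]
  | h2 z₁ z₂ h₁ h₂ => rw [map_add, ip_add_left, h₁, h₂, ip_add_left]
  | h1 x m =>
    induction z' using PreTensor.ind with
    | h0 => rw [map_zero, ip_zero_right, ip_zero_right]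
    | h2 z₁ z₂ h₁ h₂ => rw [map_add, ip_add_right, h₁, h₂, ip_add_right]
    | h1 x' m' => rw [preEval_tmul, preEval_tmul, ip_dualAct, PreTensor.ip_tmul]

/-- A representation of `ℬᵃ(E)` on `H` whose rank-one operators act nondegenerately. -/
def IsNondegenerate (π : Adj B E →⋆ₐ[ℂ] Adj B H) : Prop :=
  (Submodule.span ℂ {z : H | ∃ (x y : E) (h : H), z = π (rankOne B x y) h}).topologicalClosure = ⊤

/-- The unitary `u : E ⊙ (E^* ⊙_π H) → H`, `u(x ⊙ (y^* ⊙ h)) = π(x y^*) h`. -/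
def evalIso (hπ : IsNondegenerate π) : IntTensor E (dualLeft π) ≃ₗᵢ[ℂ] H :=
  -- The range contains every $\pi(xy^*)h$, as the image of $x\otimes(y^*\odot h)$; these vectors
  -- are total by nondegeneracy.
  completionIso (preEval π) ip_preEval (top_le_iff.1 (hπ.symm.le.trans
    (Submodule.topologicalClosure_mono (Submodule.span_mono (by
      rintro _ ⟨x, y, h, rfl⟩
      exact ⟨PreTensor.tmul _ x (tmul π (dual y) h), dualAct_tmul x y h⟩)))))

lemma ip_evalIso (hπ : IsNondegenerate π) (z z' : IntTensor E (dualLeft π)) :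
    ⟪evalIso hπ z, evalIso hπ z'⟫_B = ⟪z, z'⟫_B := ip_completionIso _ _ _ _ _

lemma evalIso_amp (hπ : IsNondegenerate π) (a : Adj B E) (z : IntTensor E (dualLeft π)) :
    evalIso hπ (amp (dualLeft π) a z) = π a (evalIso hπ z) := by
  induction z using HilbertCompletion.ind with
  | hp =>
    exact isClosed_eq ((evalIso hπ).continuous.comp (amp (dualLeft π) a).1.continuous)
      ((π a).1.continuous.comp (evalIso hπ).continuous)
  | h z =>
    rw [amp_of]
    refine (completionIso_of _ _ _ _).trans (Eq.trans ?_
      (congrArg (π a) (completionIso_of _ _ _ z).symm))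
    induction z using PreTensor.ind with
    | h0 => simp only [map_zero]
    | h2 z₁ z₂ h₁ h₂ => simp only [map_add, h₁, h₂]
    | h1 x m => exact dualAct_apply a x m

/-- The vector `ξ^* ⊙ h` is central if `π(x (ξ b^*)^*) h = π(x ξ^*) h b`. -/
lemma dualLeft_tmul_eq_op_smul {ξ : E} {h : H}
    (hh : ∀ (x : E) (b : B), π (rankOne B x (op (star b) • ξ)) h
      = op b • π (rankOne B x ξ) h) (b : B) :
    dualLeft π b (tmul π (dual ξ) h) = op b • tmul π (dual ξ) h := by
  refine ext_ip (B := B) fun z => ?_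
  induction z using HilbertCompletion.ind with
  | hp => exact isClosed_eq (by fun_prop) (by fun_prop)
  | h z =>
    induction z using PreTensor.ind with
    | h0 => simp only [map_zero, ip_zero_left]
    | h2 z₁ z₂ h₁ h₂ => simp only [map_add, ip_add_left, h₁, h₂]
    | h1 x k =>
      change ⟪tmul π x k, _⟫_B = ⟪tmul π x k, _⟫_B
      -- Pairing with $x^*\odot k$ turns the left action on $\xi^*\odot h$ into $\langle k,\pi(x(\xi
      -- b^*)^*)h\rangle$, where the hypothesis applies.
      rw [dualLeft_tmul, ip_op_smul_right, ip_tmul, ip_tmul, DualModule.ip_def, DualModule.ip_def,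
        undual_dual, undual_dual, hh, ip_op_smul_right]

end DualTensor

/-! ### Central unit vectors and embeddings. -/

section Amp

variable {B : Type u} {E : Type v} {F : Type w} [CStarAlgebra B] [PartialOrder B] [StarOrderedRing B]
  [NormedAddCommGroup E] [NormedSpace ℂ E] [CompleteSpace E] [Module Bᵐᵒᵖ E] [HilbertModule B E]
  [NormedAddCommGroup F] [NormedSpace ℂ F] [CompleteSpace F] [Module Bᵐᵒᵖ F] [HilbertModule B F]
  {l : B →⋆ₐ[ℂ] Adj B F} {ω : F}

/-- Centrality moves the scalar out on the right: $\langle\omega,\langle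
x,y\rangle\omega\rangle=\langle\omega,\omega\rangle\langle x,y\rangle$. So $x\mapsto x\odot\omega$
embeds $E$ isometrically, compatibly with $a\mapsto a\odot\mathrm{id}$. -/
lemma ip_tmul_central (hω : ⟪ω, ω⟫_B = 1) (hc : ∀ b, l b ω = op b • ω) (x y : E) :
    ⟪tmul l x ω, tmul l y ω⟫_B = ⟪x, y⟫_B := by
  rw [ip_tmul, hc, ip_op_smul_right, hω, one_mul]

/-- The operator $a$ can be read off from $a\odot\mathrm{id}$ on the isometric copy $E\odot\omega$
of $E$. -/
lemma amp_injective_of_central (hω : ⟪ω, ω⟫_B = 1) (hc : ∀ b, l b ω = op b • ω) :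
    Function.Injective (amp (E := E) l) := by
  refine (injective_iff_map_eq_zero _).2 fun a ha => Adj.ext' fun x => ?_
  refine eq_zero_of_ip_self (B := B) ?_
  rw [← ip_tmul_central hω hc, ← amp_tmul, ha, Adj.zero_apply, ip_zero_left]

/-- The element $b$ is recovered as $\langle\xi,(\xi b\xi^*)\xi\rangle$. -/
lemma vecEmbedding_injective {ξ : E} (hξ : ⟪ξ, ξ⟫_B = 1) :
    Function.Injective (vecEmbedding ξ hξ) := by
  refine (injective_iff_map_eq_zero _).2 fun b hb => ?_
  have h : ⟪ξ, vecEmbedding ξ hξ b ξ⟫_B = b := by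
    change ⟪ξ, rankOne B (op b • ξ) ξ ξ⟫_B = b
    rw [rankOne_apply, ip_op_smul_right, ip_op_smul_right, hξ, one_mul, mul_one]
  rw [← h, hb, Adj.zero_apply, ip_zero_right]

end Amp

end HilbMod

end

noncomputable section

namespace HilbMod

open SemiHilbert HilbertModule DualModule Filter

/-! ### Isometry semigroups that intertwine an `E₀`-semigroup -/

section Intertwiner

/-- A semigroup of inner product preserving maps `V_t` on `E` with `V_t a = ϑ_t(a) V_t`. -/
structure Intertwiner {𝕋 : Type w} [AddCommMonoid 𝕋] {B : Type u} {E : Type v} [CStarAlgebra B]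
    [PartialOrder B] [NormedAddCommGroup E] [NormedSpace ℂ E] [CompleteSpace E] [Module Bᵐᵒᵖ E]
    [HilbertModule B E] (ϑ : E0Semigroup 𝕋 B E) where
  toFun : 𝕋 → E →ₗ[ℂ] E
  map_zero : ∀ x, toFun 0 x = x
  -- The order of the factors is the one that associativity of the product produces. As $\mathbb T$
  -- is commutative, all the $V_t$ commute.
  map_add : ∀ s t x, toFun (s + t) x = toFun t (toFun s x)
  ip : ∀ t x y, ⟪toFun t x, toFun t y⟫_B = ⟪x, y⟫_B
  map_adj : ∀ t (a : Adj B E) x, toFun t (a x) = ϑ t a (toFun t x)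

instance {𝕋 : Type w} [AddCommMonoid 𝕋] {B : Type u} {E : Type v} [CStarAlgebra B]
    [PartialOrder B] [NormedAddCommGroup E] [NormedSpace ℂ E] [CompleteSpace E] [Module Bᵐᵒᵖ E]
    [HilbertModule B E] (ϑ : E0Semigroup 𝕋 B E) :
    CoeFun (Intertwiner ϑ) fun _ => 𝕋 → E →ₗ[ℂ] E := ⟨Intertwiner.toFun⟩

variable {B : Type u} {E : Type v} [CStarAlgebra B] [PartialOrder B] [StarOrderedRing B]
  [NormedAddCommGroup E] [NormedSpace ℂ E] [CompleteSpace E] [Module Bᵐᵒᵖ E] [HilbertModule B E]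

lemma EndCorr.mul_of {φ ψ χ : Adj B E →⋆ₐ[ℂ] Adj B E} (h : ∀ a, χ a = ψ (φ a))
    (m : PreTensor (DualModule E) φ) (n : EndCorr ψ) :
    EndCorr.mul φ ψ χ (HilbertCompletion.of B m) n = preMul φ ψ χ n m :=
  HilbertCompletion.lift_of _ (norm_preMul_le h n) m

lemma EndCorr.norm_act_le {φ : Adj B E →⋆ₐ[ℂ] Adj B E} (x : E) (m : EndCorr φ) :
    ‖EndCorr.act φ x m‖ ≤ ‖m‖ * ‖x‖ := by
  refine abs_le_of_sq_le_sq' ?_ (by positivity) |>.2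
  rw [norm_sq_eq (B := B), EndCorr.ip_act, mul_pow, norm_sq_eq (B := B) x]
  have h1 : ‖EndCorr.left φ ⟪x, x⟫_B‖ ≤ ‖⟪x, x⟫_B‖ :=
    NonUnitalStarAlgHom.norm_apply_le (EndCorr.left φ) _
  have h2 := Adj.norm_apply_le (EndCorr.left φ ⟪x, x⟫_B) m
  refine (HilbertModule.norm_ip_le _ _).trans ?_
  calc _ ≤ ‖m‖ * (‖⟪x, x⟫_B‖ * ‖m‖) := by gcongr; exact h2.trans (by gcongr)
    _ = _ := by ring

/-- Continuity in the module factor, needed for the density argument in `EndCorr.act_mul`, where the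
vector of $E$ depends on $m$. -/
lemma EndCorr.continuous_act_left {φ : Adj B E →⋆ₐ[ℂ] Adj B E} (m : EndCorr φ) :
    Continuous fun x => EndCorr.act φ x m :=
  AddMonoidHomClass.continuous_of_bound
    (AddMonoidHom.mk' (fun x => EndCorr.act φ x m) fun x y => EndCorr.act_add x y m) ‖m‖
    fun x => EndCorr.norm_act_le x m

/-- Associativity: $u(x\odot u(m\odot n))=u(u(x\odot m)\odot n)$. For $m=y^*\odot z$ both sides are
$\psi(\varphi(xy^*))\,u_\psi(z\odot n)$. It converts the unit property of $\omega$ into the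
semigroup property of $V$. -/
lemma EndCorr.act_mul {φ ψ χ : Adj B E →⋆ₐ[ℂ] Adj B E} (h : ∀ a, χ a = ψ (φ a)) (x : E)
    (m : EndCorr φ) (n : EndCorr ψ) :
    EndCorr.act χ x (EndCorr.mul φ ψ χ m n) = EndCorr.act ψ (EndCorr.act φ x m) n := by
  induction m using HilbertCompletion.ind with
  | hp =>
    exact isClosed_eq ((EndCorr.act χ x).continuous.comp
        (HilbertCompletion.lift (preMul φ ψ χ n)).continuous)
      ((EndCorr.continuous_act_left n).comp (EndCorr.act φ x).continuous)
  | h m =>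
    rw [EndCorr.mul_of h]
    induction m using PreTensor.ind with
    | h0 => simpa only [_root_.map_zero, zero_smul] using (EndCorr.act_smul (0 : ℂ) (0 : E) n).symm
    | h2 m m' h h' => simp only [_root_.map_add, h, h', EndCorr.act_add]
    | h1 y z =>
      rw [preMul_tmul, ← dual_undual y, EndCorr.act_tmul]
      change _ = EndCorr.act ψ (EndCorr.act φ x (tmul φ (dual (undual y)) z)) n
      rw [EndCorr.act_tmul, EndCorr.act_apply, h]

variable {𝕋 : Type w} [AddCommMonoid 𝕋] [LinearOrder 𝕋] [IsOrderedCancelAddMonoid 𝕋]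
  [CanonicallyOrderedAdd 𝕋] {ϑ : E0Semigroup 𝕋 B E}

open Classical in
/-- The isometries `V_t x = u_t(x ⊙ ω_t)` for a central unital unit `ω`. -/
def E0Semigroup.CentralUnitalUnit.intertwiner (ω : ϑ.CentralUnitalUnit) : Intertwiner ϑ where
  -- The fiber at $0$ should be $\mathcal B$ with $\omega_0=\mathbf 1$, but the entry `ω.vec 0` lies
  -- in another module and is unconstrained; the value at $0$ is therefore set to the identity.
  toFun t := if t = 0 then LinearMap.id else
    { toFun := fun x => EndCorr.act (ϑ t) x (ω.vec t)
      map_add' := fun x y => EndCorr.act_add x y _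
      map_smul' := fun c x => EndCorr.act_smul c x _ }
  map_zero x := by rw [if_pos rfl]; rfl
  map_add s t x := by
    by_cases hs : s = 0
    · rw [hs, if_pos rfl, zero_add]; rfl
    by_cases ht : t = 0
    · rw [ht, if_pos rfl, add_zero]; rfl
    -- In a canonically ordered monoid $s+t=0$ forces $s=0$.
    rw [if_neg hs, if_neg ht, if_neg (by simp [hs])]
    change EndCorr.act (ϑ (s + t)) x (ω.vec (s + t))
      = EndCorr.act (ϑ t) (EndCorr.act (ϑ s) x (ω.vec s)) (ω.vec t)
    rw [← ω.mul s t hs ht]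
    exact EndCorr.act_mul (fun a => by rw [add_comm, ϑ.map_add]) x _ _
  ip t x y := by
    split_ifs with ht
    · rfl
    · refine (EndCorr.ip_act x y _ _).trans ?_
      -- Isometry of $V_t$ is $\langle\omega_t,\langle
      -- x,y\rangle\omega_t\rangle=\langle\omega_t,\omega_t\rangle\langle x,y\rangle=\langle
      -- x,y\rangle$.
      rw [ω.central t ht, ip_op_smul_right, ω.unital t ht, one_mul]
  map_adj t a x := by
    split_ifs with ht
    · subst ht; rw [ϑ.map_zero]; rfl
    · exact EndCorr.act_apply a x _

end Intertwiner

/-! ### The inductive limit along an intertwiner -/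

section Orbits

variable {𝕋 : Type w} [AddCommMonoid 𝕋] [LinearOrder 𝕋] [IsOrderedCancelAddMonoid 𝕋]
  [CanonicallyOrderedAdd 𝕋]
  {B : Type u} {E : Type v} [CStarAlgebra B] [PartialOrder B] [StarOrderedRing B]
  [NormedAddCommGroup E] [NormedSpace ℂ E] [CompleteSpace E] [Module Bᵐᵒᵖ E] [HilbertModule B E]
  {ϑ : E0Semigroup 𝕋 B E} (V : Intertwiner ϑ)

namespace Intertwiner

/-- The functions `f : 𝕋 → E` with `f (s + r) = V_r (f s)` for all large `s`. Modulo eventual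
equality they form the inductive limit of copies of `E` along the isometries `V_r`. -/
def orbitSubmodule : Submodule ℂ (𝕋 → E) where
  carrier := {f | ∀ᶠ s in atTop, ∀ r, f (s + r) = V r (f s)}
  zero_mem' := Eventually.of_forall fun s r => (_root_.map_zero (V r)).symm
  add_mem' := by
    intro f g hf hg
    filter_upwards [hf, hg] with s hs hs' r
    rw [Pi.add_apply, Pi.add_apply, hs, hs', _root_.map_add]
  smul_mem' := by
    intro c f hf
    filter_upwards [hf] with s hs r
    rw [Pi.smul_apply, Pi.smul_apply, hs, map_smul]

/-- The inductive limit of copies of `E` along the isometries `V_r`, before completion. -/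
def Orbits : Type (max v w) := V.orbitSubmodule

namespace Orbits

instance : AddCommGroup V.Orbits := inferInstanceAs (AddCommGroup V.orbitSubmodule)
instance : Module ℂ V.Orbits := inferInstanceAs (Module ℂ V.orbitSubmodule)

variable {V}

instance : CoeFun V.Orbits fun _ => 𝕋 → E := ⟨fun f => f.1⟩

lemma ext {f g : V.Orbits} (h : ∀ s, f s = g s) : f = g := Subtype.ext (funext h)

lemma eventually (f : V.Orbits) : ∀ᶠ s in atTop, ∀ r, f (s + r) = V r (f s) := f.2

lemma add_apply (f g : V.Orbits) (s : 𝕋) : (f + g) s = f s + g s := rfl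
lemma smul_apply (c : ℂ) (f : V.Orbits) (s : 𝕋) : (c • f) s = c • f s := rfl

instance : SMul Bᵐᵒᵖ V.Orbits :=
  ⟨fun b f => ⟨fun s => b • f s, by
    filter_upwards [f.eventually] with s hs r
    obtain ⟨b, rfl⟩ := op_surjective b
    rw [hs, map_op_smul_of_ip (V.ip r)]⟩⟩

lemma op_smul_apply (b : Bᵐᵒᵖ) (f : V.Orbits) (s : 𝕋) : (b • f) s = b • f s := rfl

instance : Module Bᵐᵒᵖ V.Orbits where
  one_smul f := ext fun s => one_smul _ (f s)
  mul_smul b c f := ext fun s => mul_smul b c (f s)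
  smul_zero b := ext fun _ => smul_zero b
  smul_add b f g := ext fun s => smul_add b (f s) (g s)
  add_smul b c f := ext fun s => add_smul b c (f s)
  zero_smul f := ext fun s => zero_smul _ (f s)

/-- Beyond a common threshold $t$ both functions move by the same isometries $V_r$, so their inner
product no longer changes. -/
lemma exists_ip (f g : V.Orbits) : ∃ c : B, ∀ᶠ s in atTop, ⟪f s, g s⟫_B = c := by
  obtain ⟨t, hf, hg⟩ := (f.eventually.and g.eventually).exists
  refine ⟨⟪f t, g t⟫_B, (eventually_ge_atTop t).mono fun s hs => ?_⟩
  obtain ⟨r, rfl⟩ := exists_add_of_le hs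
  rw [hf, hg, V.ip]

/-- The eventually constant value of `⟪f s, g s⟫`. -/
@[reducible] def innerOrbits : Inner B V.Orbits := ⟨fun f g => (exists_ip f g).choose⟩

section Inner

attribute [local instance] innerOrbits

lemma eventually_ip_aux (f g : V.Orbits) : ∀ᶠ s in atTop, ⟪f, g⟫_B = ⟪f s, g s⟫_B :=
  (exists_ip f g).choose_spec.mono fun _ h => h.symm

instance : SemiHilbert B V.Orbits where
  toInner := innerOrbits
  ip_add_right f g g' := by
    obtain ⟨s, h₁, h₂, h₃⟩ := ((eventually_ip_aux f (g + g')).and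
      ((eventually_ip_aux f g).and (eventually_ip_aux f g'))).exists
    rw [h₁, h₂, h₃, add_apply, ip_add_right]
  ip_smul_right c f g := by
    obtain ⟨s, h₁, h₂⟩ := ((eventually_ip_aux f (c • g)).and (eventually_ip_aux f g)).exists
    rw [h₁, h₂, smul_apply, ip_smul_right]
  ip_op_smul_right b f g := by
    obtain ⟨s, h₁, h₂⟩ := ((eventually_ip_aux f (op b • g)).and (eventually_ip_aux f g)).exists
    rw [h₁, h₂, op_smul_apply, ip_op_smul_right]
  star_ip f g := by
    obtain ⟨s, h₁, h₂⟩ := ((eventually_ip_aux f g).and (eventually_ip_aux g f)).exists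
    rw [h₁, h₂, star_ip]
  ip_self_nonneg f := by
    obtain ⟨s, h⟩ := (eventually_ip_aux f f).exists
    rw [h]; exact ip_self_nonneg _

end Inner

lemma eventually_ip (f g : V.Orbits) : ∀ᶠ s in atTop, ⟪f, g⟫_B = ⟪f s, g s⟫_B :=
  eventually_ip_aux f g

lemma eventually_norm (f : V.Orbits) : ∀ᶠ s in atTop, ‖HilbertCompletion.of B f‖ = ‖f s‖ :=
  (eventually_ip f f).mono fun s h => by
    rw [HilbertCompletion.norm_of, h, ← norm_eq (B := B) (f s)]

/-- The seminorm is the eventual value of $\|f(s)\|$, so the completion itself identifies functions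
that eventually agree; no separate quotient is taken. -/
lemma of_eq_of_eventually {f g : V.Orbits} (h : ∀ᶠ s in atTop, f s = g s) :
    HilbertCompletion.of B f = HilbertCompletion.of B g := by
  obtain ⟨s, hs, h⟩ := ((eventually_norm (f - g)).and h).exists
  rw [← sub_eq_zero, ← map_sub, ← norm_eq_zero, hs]
  change ‖f s - g s‖ = 0
  rw [h, sub_self, norm_zero]

lemma of_eq_of_forall_add (t : 𝕋) {f g : V.Orbits} (h : ∀ r, f (t + r) = g (t + r)) :
    HilbertCompletion.of B f = HilbertCompletion.of B g :=
  of_eq_of_eventually ((eventually_ge_atTop t).mono fun s hs => by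
    obtain ⟨r, rfl⟩ := exists_add_of_le hs
    exact h r)

open Classical in
variable (V) in
/-- The function of the vector `x` in the copy of `E` with index `t`. -/
def pointFun (t : 𝕋) (x : E) (s : 𝕋) : E := if h : ∃ r, s = t + r then V h.choose x else 0

/-- Cancellation in $\mathbb T$ makes the chosen $r$ with $s=t+r$ unique. -/
lemma pointFun_add (t r : 𝕋) (x : E) : pointFun V t x (t + r) = V r x := by
  have h : ∃ p, t + r = t + p := ⟨r, rfl⟩
  rw [pointFun, dif_pos h, ← add_left_cancel h.choose_spec]

variable (V) in
/-- The vector `x` of the copy of `E` with index `t`. -/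
def point (t : 𝕋) : E →ₗ[ℂ] V.Orbits where
  toFun x := ⟨pointFun V t x, by
    filter_upwards [eventually_ge_atTop t] with s hs r
    obtain ⟨q, rfl⟩ := exists_add_of_le hs
    rw [add_assoc, pointFun_add, pointFun_add, V.map_add]⟩
  map_add' x y := ext fun s => by
    change pointFun V t _ s = pointFun V t _ s + pointFun V t _ s
    simp only [pointFun]
    split_ifs
    · exact _root_.map_add _ x y
    · exact (add_zero _).symm
  map_smul' c x := ext fun s => by
    change pointFun V t _ s = c • pointFun V t _ s
    simp only [pointFun]
    split_ifs
    · exact _root_.map_smul _ c x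
    · exact (smul_zero _).symm

lemma point_add (t r : 𝕋) (x : E) : point V t x (t + r) = V r x := pointFun_add t r x

/-- Past its threshold $t$ a function is generated by its value there. Hence the copies of $E$
exhaust the limit before completion, and statements about the limit may be checked on them. -/
lemma exists_eq_point (f : V.Orbits) : ∃ t x, HilbertCompletion.of B f
    = HilbertCompletion.of B (point V t x) := by
  obtain ⟨t, ht⟩ := f.eventually.exists
  exact ⟨t, f t, of_eq_of_forall_add t fun r => by rw [ht, point_add]⟩

/-- The action `(a f)(s) = ϑ_s(a) f(s)`. -/
def map (a : Adj B E) : V.Orbits →ₗ[ℂ] V.Orbits where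
  toFun f := ⟨fun s => ϑ s a (f s), by
    filter_upwards [f.eventually] with s hs r
    -- Here $\vartheta_{s+r}(a)V_rf(s)=\vartheta_r(\vartheta_s(a))V_rf(s)=V_r\vartheta_s(a)f(s)$.
    rw [hs, add_comm, ϑ.map_add, V.map_adj]⟩
  map_add' f g := ext fun s => _root_.map_add (ϑ s a).1 (f s) (g s)
  map_smul' c f := ext fun s => _root_.map_smul (ϑ s a).1 c (f s)

lemma map_apply (a : Adj B E) (f : V.Orbits) (s : 𝕋) : map a f s = ϑ s a (f s) := rfl

lemma norm_map_le (a : Adj B E) (f : V.Orbits) :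
    ‖HilbertCompletion.of B (map a f)‖ ≤ ‖a‖ * ‖HilbertCompletion.of B f‖ := by
  obtain ⟨s, h₁, h₂⟩ := ((eventually_norm (map a f)).and (eventually_norm f)).exists
  rw [h₁, h₂, map_apply]
  refine (Adj.norm_apply_le _ _).trans ?_
  gcongr
  exact NonUnitalStarAlgHom.norm_apply_le (ϑ s) a

lemma ip_map (a : Adj B E) (f g : V.Orbits) : ⟪map a f, g⟫_B = ⟪f, map (star a) g⟫_B := by
  obtain ⟨s, h₁, h₂⟩ := ((eventually_ip (map a f) g).and (eventually_ip f (map (star a) g))).exists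
  rw [h₁, h₂, map_apply, map_apply, map_star, Adj.ip_star_right]

/-- The isometries `V_t`, applied pointwise. -/
def shift (t : 𝕋) : V.Orbits →ₗ[ℂ] V.Orbits where
  toFun f := ⟨fun s => V t (f s), by
    filter_upwards [f.eventually] with s hs r
    rw [hs, ← V.map_add, ← V.map_add, add_comm]⟩
  map_add' f g := ext fun s => _root_.map_add (V t) (f s) (g s)
  map_smul' c f := ext fun s => _root_.map_smul (V t) c (f s)

lemma shift_apply (t : 𝕋) (f : V.Orbits) (s : 𝕋) : shift t f s = V t (f s) := rfl

lemma ip_shift (t : 𝕋) (f g : V.Orbits) : ⟪shift t f, shift t g⟫_B = ⟪f, g⟫_B := by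
  obtain ⟨s, h₁, h₂⟩ := ((eventually_ip (shift t f) (shift t g)).and (eventually_ip f g)).exists
  rw [h₁, h₂, shift_apply, shift_apply, V.ip]

/-- The copy $s$ sits inside the copy $s+t$ through $V_t$, so applying $V_t$ in the copy $s+t$
amounts to moving the vector unchanged to the copy $s$. This gives the surjectivity that the
isometries lack on $E$. -/
lemma of_shift_point (t s : 𝕋) (x : E) :
    HilbertCompletion.of B (shift t (point V (s + t) x)) = HilbertCompletion.of B (point V s x) :=
  of_eq_of_forall_add (s + t) fun r => by
    rw [shift_apply, point_add, add_assoc, point_add, ← V.map_add, add_comm]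

end Orbits

/-! ### The representation on the inductive limit and the unitaries that extend the isometries. -/

open Orbits

/-- The inductive limit of copies of `E` along the isometries `V_r`. -/
abbrev Limit : Type (max v w) := HilbertCompletion B V.Orbits

/-- The action of `ℬᵃ(E)` on the inductive limit: `ϑ_t(a)` on the copy of `E` with index `t`. -/
def rep : Adj B E →⋆ₐ[ℂ] Adj B V.Limit :=
  let L (a : Adj B E) : V.Limit →L[ℂ] V.Limit :=
    HilbertCompletion.lift ((HilbertCompletion.of B).comp (map a))
  have hL (a : Adj B E) (f : V.Orbits) :
      L a (HilbertCompletion.of B f) = HilbertCompletion.of B (map a f) :=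
    HilbertCompletion.lift_of _ (norm_map_le a) f
  have hadj (a : Adj B E) (f g : V.Limit) : ⟪L a f, g⟫_B = ⟪f, L (star a) g⟫_B := by
    induction f using HilbertCompletion.ind with
    | hp => exact isClosed_eq (by fun_prop) (by fun_prop)
    | h f =>
    induction g using HilbertCompletion.ind with
    | hp => exact isClosed_eq (by fun_prop) (by fun_prop)
    | h g => rw [hL, hL, HilbertCompletion.ip_of, HilbertCompletion.ip_of, ip_map]
  have hext {a b : Adj B V.Limit} (h : ∀ f : V.Orbits, a (HilbertCompletion.of B f)
      = b (HilbertCompletion.of B f)) : a = b := Adj.ext' fun f => by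
    induction f using HilbertCompletion.ind with
    | hp => exact isClosed_eq a.1.continuous b.1.continuous
    | h f => exact h f
  { toFun := fun a => Adj.mk' (L a) (L (star a)) (hadj a)
    map_one' := hext fun f => (hL 1 f).trans (congrArg _ (ext fun s => by
      rw [map_apply, _root_.map_one, Adj.one_apply]))
    map_mul' := fun a b => hext fun f => by
      rw [Adj.mul_apply, Adj.mk'_apply, Adj.mk'_apply, Adj.mk'_apply, hL, hL, hL]
      exact congrArg _ (ext fun s => by
        rw [map_apply, map_apply, map_apply, _root_.map_mul, Adj.mul_apply])
    map_zero' := hext fun f => (hL 0 f).trans (by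
      rw [Adj.zero_apply, ← _root_.map_zero (HilbertCompletion.of B)]
      exact congrArg _ (ext fun s => by rw [map_apply, _root_.map_zero]; rfl))
    map_add' := fun a b => hext fun f => by
      rw [Adj.add_apply, Adj.mk'_apply, Adj.mk'_apply, Adj.mk'_apply, hL, hL, hL,
        ← _root_.map_add]
      exact congrArg _ (ext fun s => by rw [map_apply, _root_.map_add]; rfl)
    commutes' := fun c => hext fun f => by
      rw [Algebra.algebraMap_eq_smul_one, Algebra.algebraMap_eq_smul_one, Adj.smul_apply,
        Adj.one_apply, Adj.mk'_apply, hL, ← map_smul]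
      exact congrArg _ (ext fun s => by rw [map_apply, map_smul, _root_.map_one]; rfl)
    map_star' := fun a => Adj.eq_star (hadj a) }

lemma rep_of (a : Adj B E) (f : V.Orbits) :
    V.rep a (HilbertCompletion.of B f) = HilbertCompletion.of B (map a f) :=
  HilbertCompletion.lift_of _ (norm_map_le a) f

/-- The canonical isometry of the copy of `E` with index `t` into the inductive limit. -/
def incl (t : 𝕋) : E →ₗ[ℂ] V.Limit := (HilbertCompletion.of B).comp (point V t)

lemma ip_incl (t : 𝕋) (x y : E) : ⟪V.incl t x, V.incl t y⟫_B = ⟪x, y⟫_B := by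
  refine (HilbertCompletion.ip_of _ _).trans ?_
  obtain ⟨s, h, hs⟩ :=
    ((eventually_ip (point V t x) (point V t y)).and (eventually_ge_atTop t)).exists
  obtain ⟨r, rfl⟩ := exists_add_of_le hs
  rw [h, point_add, point_add, V.ip]

lemma continuous_incl (t : 𝕋) : Continuous (V.incl t) :=
  AddMonoidHomClass.continuous_of_bound (V.incl t) 1 fun x => by
    rw [norm_eq (B := B), ip_incl, one_mul, norm_eq (B := B) x]

/-- Holds since $\vartheta_{t+r}(a)V_r=V_r\vartheta_t(a)$. On the copy with index $0$ the
representation is thus the original action on $E$. -/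
lemma rep_incl (t : 𝕋) (a : Adj B E) (x : E) : V.rep a (V.incl t x) = V.incl t (ϑ t a x) :=
  (V.rep_of a _).trans (of_eq_of_forall_add t fun r => by
    rw [map_apply, point_add, point_add, V.map_adj, ← ϑ.map_add, add_comm])

lemma dense_shift (t : 𝕋) : (Submodule.span ℂ (Set.range
    ((HilbertCompletion.of B).comp (shift (V := V) t)))).topologicalClosure = ⊤ := by
  refine Submodule.dense_iff_topologicalClosure_eq_top.1
    (HilbertCompletion.denseRange_of.mono ?_)
  rintro _ ⟨f, rfl⟩
  obtain ⟨s, x, h⟩ := exists_eq_point f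
  rw [h, ← of_shift_point t]
  exact Submodule.subset_span ⟨_, rfl⟩

/-- The unitary extension of the isometry `V_t` to the inductive limit. -/
def shiftIso (t : 𝕋) : V.Limit ≃ₗᵢ[ℂ] V.Limit :=
  completionIso ((HilbertCompletion.of B).comp (shift t))
    (fun f g => (HilbertCompletion.ip_of _ _).trans (ip_shift t f g)) (V.dense_shift t)

lemma shiftIso_of (t : 𝕋) (f : V.Orbits) :
    V.shiftIso t (HilbertCompletion.of B f) = HilbertCompletion.of B (shift t f) :=
  completionIso_of _ _ _ f

lemma ip_shiftIso (t : 𝕋) (f g : V.Limit) : ⟪V.shiftIso t f, V.shiftIso t g⟫_B = ⟪f, g⟫_B :=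
  ip_completionIso _ _ _ _ _

lemma shiftIso_zero (f : V.Limit) : V.shiftIso 0 f = f := by
  induction f using HilbertCompletion.ind with
  | hp => exact isClosed_eq (V.shiftIso 0).continuous continuous_id
  | h f =>
    rw [shiftIso_of]
    exact congrArg _ (ext fun s => V.map_zero _)

lemma shiftIso_add (s t : 𝕋) (f : V.Limit) :
    V.shiftIso (s + t) f = V.shiftIso s (V.shiftIso t f) := by
  induction f using HilbertCompletion.ind with
  | hp =>
    exact isClosed_eq (V.shiftIso _).continuous
      ((V.shiftIso s).continuous.comp (V.shiftIso t).continuous)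
  | h f =>
    rw [shiftIso_of, shiftIso_of, shiftIso_of]
    exact congrArg _ (ext fun r => by
      rw [shift_apply, shift_apply, shift_apply, add_comm, V.map_add])

/-- The relation that makes $\vartheta$ unitarily implemented on the limit. Pointwise it reads
$V_t\vartheta_s(a)=\vartheta_t(\vartheta_s(a))V_t=\vartheta_s(\vartheta_t(a))V_t$, the last step by
commutativity of $\mathbb T$. -/
lemma shiftIso_rep (t : 𝕋) (a : Adj B E) (f : V.Limit) :
    V.shiftIso t (V.rep a f) = V.rep (ϑ t a) (V.shiftIso t f) := by
  induction f using HilbertCompletion.ind with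
  | hp =>
    exact isClosed_eq ((V.shiftIso t).continuous.comp (V.rep a).1.continuous)
      ((V.rep (ϑ t a)).1.continuous.comp (V.shiftIso t).continuous)
  | h f =>
    rw [rep_of, shiftIso_of, shiftIso_of, rep_of]
    exact congrArg _ (ext fun r => by
      rw [shift_apply, map_apply, map_apply, shift_apply, V.map_adj, ← ϑ.map_add, ← ϑ.map_add,
        add_comm])

/-- In the copy with index $t$ the compacts act as $\vartheta_t(\mathcal K(E))$, which is
nondegenerate by strictness of $\vartheta_t$; the copies together are dense. -/
lemma isNondegenerate_rep (hϑ : ϑ.IsStrict) : IsNondegenerate V.rep := by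
  set N := (Submodule.span ℂ {z : V.Limit | ∃ (x y : E) (h : V.Limit),
    z = V.rep (rankOne B x y) h}).topologicalClosure
  have hc : IsClosed (N : Set V.Limit) := Submodule.isClosed_topologicalClosure _
  have h₁ (f : V.Limit) {a : Adj B E} (ha : a ∈ compacts B E) : V.rep a f ∈ N := by
    let L : Adj B E →ₗ[ℂ] V.Limit :=
      { toFun := fun a => V.rep a f
        map_add' := fun a b => by rw [_root_.map_add, Adj.add_apply]
        map_smul' := fun c a => by rw [map_smul, Adj.smul_apply, RingHom.id_apply] }
    have hL : Continuous L := AddMonoidHomClass.continuous_of_bound L ‖f‖ fun a => by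
      rw [mul_comm]
      refine (Adj.norm_apply_le (V.rep a) f).trans ?_
      gcongr
      exact NonUnitalStarAlgHom.norm_apply_le V.rep a
    -- The operators that map $f$ into the closed subspace `N` form a closed subspace containing the
    -- rank-one operators.
    have hle : compacts B E ≤ N.comap L := by
      refine Submodule.topologicalClosure_minimal _ (Submodule.span_le.2 ?_) (hc.preimage hL)
      rintro _ ⟨x, y, rfl⟩
      exact Submodule.le_topologicalClosure _ (Submodule.subset_span ⟨x, y, f, rfl⟩)
    exact hle ha
  have h₂ (t : 𝕋) (x : E) : V.incl t x ∈ N := by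
    -- Strictness at $t$: the vectors $\vartheta_t(a)x$ with $a$ compact are total in $E$, and their
    -- images are $\mathrm{rep}(a)$ applied to the copy.
    have hle : (⊤ : Submodule ℂ E) ≤ N.comap (V.incl t) := by
      rw [← hϑ t]
      refine Submodule.topologicalClosure_minimal _ (Submodule.span_le.2 ?_)
        (hc.preimage (V.continuous_incl t))
      rintro _ ⟨a, ha, x, rfl⟩
      change V.incl t (ϑ t a x) ∈ N
      rw [← rep_incl]
      exact h₁ _ ha
    exact hle Submodule.mem_top
  suffices h₃ : ∀ f : V.Limit, f ∈ N from eq_top_iff.2 fun f _ => h₃ f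
  intro f
  induction f using HilbertCompletion.ind with
  | hp => exact hc
  | h f =>
    obtain ⟨t, x, h⟩ := exists_eq_point f
    rw [h]
    exact h₂ t x

/-! ### Transport of the unitaries to the tensor product. -/

/-- The unitary `u^* W_t u` on `E ⊙ (E^* ⊙ H)`, for the inductive limit `H` with its unitaries
`W_t`. -/
def dilationIso (hϑ : ϑ.IsStrict) (t : 𝕋) :
    IntTensor E (dualLeft V.rep) ≃ₗᵢ[ℂ] IntTensor E (dualLeft V.rep) :=
  ((evalIso (V.isNondegenerate_rep hϑ)).trans (V.shiftIso t)).trans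
    (evalIso (V.isNondegenerate_rep hϑ)).symm

lemma evalIso_dilationIso (hϑ : ϑ.IsStrict) (t : 𝕋) (z : IntTensor E (dualLeft V.rep)) :
    evalIso (V.isNondegenerate_rep hϑ) (V.dilationIso hϑ t z)
      = V.shiftIso t (evalIso (V.isNondegenerate_rep hϑ) z) :=
  LinearIsometryEquiv.apply_symm_apply _ _

lemma ip_dilationIso (hϑ : ϑ.IsStrict) (t : 𝕋) (z z' : IntTensor E (dualLeft V.rep)) :
    ⟪V.dilationIso hϑ t z, V.dilationIso hϑ t z'⟫_B = ⟪z, z'⟫_B := by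
  rw [← ip_evalIso (V.isNondegenerate_rep hϑ), evalIso_dilationIso, evalIso_dilationIso,
    ip_shiftIso, ip_evalIso]

lemma dilationIso_zero (hϑ : ϑ.IsStrict) (z : IntTensor E (dualLeft V.rep)) :
    V.dilationIso hϑ 0 z = z :=
  (evalIso (V.isNondegenerate_rep hϑ)).injective
    ((V.evalIso_dilationIso hϑ 0 z).trans (V.shiftIso_zero _))

lemma dilationIso_add (hϑ : ϑ.IsStrict) (s t : 𝕋) (z : IntTensor E (dualLeft V.rep)) :
    V.dilationIso hϑ (s + t) z = V.dilationIso hϑ s (V.dilationIso hϑ t z) :=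
  (evalIso (V.isNondegenerate_rep hϑ)).injective
    ((V.evalIso_dilationIso hϑ (s + t) z).trans ((V.shiftIso_add s t _).trans
      ((congrArg _ (V.evalIso_dilationIso hϑ t z)).symm.trans
        (V.evalIso_dilationIso hϑ s _).symm)))

/-- After applying $u$, which turns $a\odot\mathrm{id}$ into $\mathrm{rep}(a)$, this is the
covariance relation `shiftIso_rep`. -/
lemma dilationIso_amp (hϑ : ϑ.IsStrict) (t : 𝕋) (a : Adj B E)
    (z : IntTensor E (dualLeft V.rep)) :
    V.dilationIso hϑ t (amp (dualLeft V.rep) a z)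
      = amp (dualLeft V.rep) (ϑ t a) (V.dilationIso hϑ t z) :=
  (evalIso (V.isNondegenerate_rep hϑ)).injective
    ((V.evalIso_dilationIso hϑ t _).trans ((congrArg _ (evalIso_amp _ a z)).trans
      ((V.shiftIso_rep t a _).trans ((congrArg _ (V.evalIso_dilationIso hϑ t z)).symm.trans
        (evalIso_amp _ _ _).symm))))

/-- The unitaries `u^* W_t u` as a semigroup. -/
def dilation (hϑ : ϑ.IsStrict) :
    Multiplicative 𝕋 →* unitary (Adj B (IntTensor E (dualLeft V.rep))) :=
  unitarySemigroup (V.dilationIso hϑ) (V.ip_dilationIso hϑ) (V.dilationIso_zero hϑ)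
    (V.dilationIso_add hϑ)

lemma ofUnitary_dilation (hϑ : ϑ.IsStrict) (t : 𝕋) (a : Adj B E) :
    E0Semigroup.ofUnitary (V.dilation hϑ) t (amp (dualLeft V.rep) a)
      = amp (dualLeft V.rep) (ϑ t a) :=
  ofUnitary_unitarySemigroup _ _ _ _ (V.dilationIso_amp hϑ t a)

/-! ### The central unit vector and the dilation property. -/

/-- The vector `ξ^* ⊙ ξ`, with the second factor in the copy of `E` with index `0`. -/
def centralVec (ξ : E) : IntTensor (DualModule E) V.rep := tmul V.rep (dual ξ) (V.incl 0 ξ)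

/-- As $\vartheta_0=\mathrm{id}$ on the copy with index $0$, the inner product is
$\langle\xi,\xi\xi^*\xi\rangle=\langle\xi,\xi\rangle^2$. -/
lemma ip_centralVec {ξ : E} (hξ : ⟪ξ, ξ⟫_B = 1) : ⟪V.centralVec ξ, V.centralVec ξ⟫_B = 1 := by
  rw [centralVec, ip_tmul, DualModule.ip_def, undual_dual, rep_incl, ϑ.map_zero, ip_incl,
    rankOne_apply, ip_op_smul_right, hξ, one_mul]

/-- In the copy with index $0$ one has $x(\xi b^*)^*\xi=xb\langle\xi,\xi\rangle=xb=(x\xi^*\xi)b$,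
the criterion of `dualLeft_tmul_eq_op_smul`. -/
lemma dualLeft_centralVec {ξ : E} (hξ : ⟪ξ, ξ⟫_B = 1) (b : B) :
    dualLeft V.rep b (V.centralVec ξ) = op b • V.centralVec ξ :=
  dualLeft_tmul_eq_op_smul (fun x b => by
    rw [rep_incl, rep_incl, ϑ.map_zero, ϑ.map_zero, rankOne_apply, rankOne_apply,
      ip_op_smul_left, hξ, star_star, mul_one, op_one, one_smul,
      map_op_smul_of_ip (V.ip_incl 0)]) b

/-- Since $\alpha_t(a\odot\mathrm{id})=\vartheta_t(a)\odot\mathrm{id}$ and $x\mapsto x\odot\omega_-$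
is isometric, the vector expectation equals $\langle\xi,\vartheta_t(\xi b\xi^*)\xi\rangle$, which is
$T_t(b)$ for a weak dilation. -/
lemma isDilation_dilation (hϑ : ϑ.IsStrict) {ξ : E} {T : UnitalCPSemigroup 𝕋 B}
    (hξ : ϑ.IsWeakDilation ξ T) :
    (E0Semigroup.ofUnitary (V.dilation hϑ)).IsDilation
      ((amp (E := E) (dualLeft V.rep)).toNonUnitalStarAlgHom.comp (vecEmbedding ξ hξ.unit))
      (tmul (dualLeft V.rep) ξ (V.centralVec ξ)) T where
  injective := (amp_injective_of_central (V.ip_centralVec hξ.unit)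
    (V.dualLeft_centralVec hξ.unit)).comp (vecEmbedding_injective hξ.unit)
  unit := by
    rw [ip_tmul_central (V.ip_centralVec hξ.unit) (V.dualLeft_centralVec hξ.unit), hξ.unit]
  eq t b := by
    have h : E0Semigroup.ofUnitary (V.dilation hϑ) t
        ((amp (E := E) (dualLeft V.rep)).toNonUnitalStarAlgHom.comp (vecEmbedding ξ hξ.unit) b)
        = amp (dualLeft V.rep) (ϑ t (vecEmbedding ξ hξ.unit b)) := V.ofUnitary_dilation hϑ t _
    rw [h, amp_tmul, ip_tmul_central (V.ip_centralVec hξ.unit) (V.dualLeft_centralVec hξ.unit),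
      hξ.eq t b]

end Intertwiner

end Orbits

end HilbMod

end

theorem mainTheorem2
    {𝕋 : Type} [AddCommMonoid 𝕋] [LinearOrder 𝕋] [IsOrderedCancelAddMonoid 𝕋]
    [CanonicallyOrderedAdd 𝕋]
    {B : Type u} [CStarAlgebra B] [PartialOrder B] [StarOrderedRing B]
    {E : Type v} [NormedAddCommGroup E] [NormedSpace ℂ E] [CompleteSpace E] [Module Bᵐᵒᵖ E]
    [HilbertModule B E]
    (ϑ : E0Semigroup 𝕋 B E) (hstrict : ϑ.IsStrict) (hspatial : ϑ.IsSpatial)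
    (T : UnitalCPSemigroup 𝕋 B) (ξ : E) (hξ : ϑ.IsWeakDilation ξ T) :
    ∃ (E' : Type v) (_ : NormedAddCommGroup E') (_ : NormedSpace ℂ E') (_ : CompleteSpace E')
      (_ : Module Bᵐᵒᵖ E') (_ : HilbertModule B E') (l : B →⋆ₐ[ℂ] Adj B E')
      (w : Multiplicative 𝕋 →* unitary (Adj B (IntTensor E l))) (ω : E'),
      Function.Injective (amp (E := E) l) ∧
      (∀ (t : 𝕋) (a : Adj B E), E0Semigroup.ofUnitary w t (amp l a) = amp l (ϑ t a)) ∧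
      ⟪ω, ω⟫_B = 1 ∧
      (∀ b : B, l b ω = op b • ω) ∧
      (E0Semigroup.ofUnitary w).IsDilation
        ((amp (E := E) l).toNonUnitalStarAlgHom.comp (vecEmbedding ξ hξ.unit)) (tmul l ξ ω) T := by
  obtain ⟨V⟩ := hspatial.map E0Semigroup.CentralUnitalUnit.intertwiner
  -- The limit consists of functions on $\mathbb T$; as `𝕋` is in `Type`, the module $E_-=E^*\odot
  -- H$ stays in the universe of `E`.
  exact ⟨IntTensor (DualModule E) V.rep, inferInstance, inferInstance, inferInstance,
    inferInstance, inferInstance, dualLeft V.rep, V.dilation hstrict, V.centralVec ξ,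
    amp_injective_of_central (V.ip_centralVec hξ.unit) (V.dualLeft_centralVec hξ.unit),
    V.ofUnitary_dilation hstrict, V.ip_centralVec hξ.unit, V.dualLeft_centralVec hξ.unit,
    V.isDilation_dilation hstrict hξ⟩
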